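/- Let $m\ge 0$ and $d\ge 1$ be integers and $[m]=\{1,\dots,m\}$. For $X\subseteq[m]$ and $\delta\ge 1$ let $C(X,\delta)=|X|_\delta\subset\mathbb{R}^\delta$ be the convex hull of the points $p_\delta(i)=(i,i^2,\dots,i^\delta)$, $i\in X$; $C(m,\delta)=C([m],\delta)$ is the cyclic polytope. A triangulation of $C(m,\delta)$ is a set $\mathcal T$ of $(\delta+1)$-subsets of $[m]$ such that the simplices $|S|_\delta$, $S\in\mathcal T$, cover $C(m,\delta)$ and any two of them intersect in their common face $|S\cap S'|_\delta$. For a $(\delta+2)$-subset $X$ of $[m]$, the lower (respectively upper) facets of the simplex $C(X,\delta+1)$, i.e. those visible from points with very large negative (respectively positive) last coordinate, give the lower (respectively upper) triangulation of $C(X,\delta)$. A triangulation $\mathcal T'$ is an increasing bistellar flip of $\mathcal T$, written $\mathcal T\lessdot_1\mathcal T'$, if for some $(\delta+2)$-subset $X$ of $[m]$ the triangulation $\mathcal T$ restricts to the lower triangulation of $C(X,\delta)$ and $\mathcal T'$ arises from $\mathcal T$ by replacing the portion inside $C(X,\delta)$ with the upper triangulation of $C(X,\delta)$. Let $s_{\mathcal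 T}\colon C(m,\delta)\to C(m,\delta+1)$ be the piecewise-linear map that sends each $|S|_\delta$, $S\in\mathcal T$, to $|S|_{\delta+1}$ by the affine map with $p_\delta(i)\mapsto p_{\delta+1}(i)$ for $i\in S$; write $\mathcal T\leqslant_2\mathcal T'$ if $s_{\mathcal T}(x)_{\delta+1}\le s_{\mathcal T'}(x)_{\delta+1}$ for all $x\in C(m,\delta)$. For $(d+1)$-subsets $A=\{a_0<\dots<a_d\}$ and $B=\{b_0<\dots<b_d\}$ of $[m]$, say that $A$ intertwines $B$, written $A\wr B$, if $a_0<b_0<a_1<b_1<\dots<a_d<b_d$. For a triangulation $\mathcal T$ of $C(m,2d)$ let $e(\mathcal T)$ be the set of all $(d+1)$-subsets $A$ of $[m]$ without two consecutive elements such that $A\subseteq S$ for some $S\in\mathcal T$. Theorem. Let $\mathcal T$ and $\mathcal T'$ be triangulations of $C(m,2d)$. (1) $\mathcal T\lessdot_1\mathcal T'$ if and only if there are a set $\mathcal U$ and $(d+1)$-tuples $A$, $B$ with $e(\mathcal T)=\mathcal U\cup\{A\}$, $e(\mathcal T')=\mathcal U\cup\{B\}$ and $A\wr B$. (2) $\mathcal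 T\leqslant_2\mathcal T'$ if and only if there are no $A\in e(\mathcal T)$ and $B\in e(\mathcal T')$ with $B\wr A$. -/

import Mathlib

open Finset

namespace CyclicPolytope

/-- The point `p(t) = (t, t ^ 2, …, t ^ δ)` of the moment curve in `ℝ ^ δ`. -/
def momentCurve (δ : ℕ) (t : ℝ) : Fin δ → ℝ := fun k => t ^ ((k : ℕ) + 1)

/-- The convex hull `C(X, δ) = |X|_δ` of the points `p(i)`, `i ∈ X`, in `ℝ ^ δ`.
If `#X = k + 1 ≤ δ + 1` this is a `k`-simplex. -/
def hull (δ : ℕ) (X : Finset ℕ) : Set (Fin δ → ℝ) :=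
  convexHull ℝ ((fun i : ℕ => momentCurve δ (i : ℝ)) '' (X : Set ℕ))

/-- The cyclic polytope `C(m, δ)`, with vertex set `[m] = {1, …, m}`. -/
def cyclicPolytope (m δ : ℕ) : Set (Fin δ → ℝ) := hull δ (Icc 1 m)

/-- `T` is (the set of `δ`-simplices of) a triangulation of `C(m, δ)`: its members are
`(δ + 1)`-subsets of `[m]`, any two of the simplices meet in their common face, and together
they cover `C(m, δ)`. -/
structure IsTriangulation (m δ : ℕ) (T : Set (Finset ℕ)) : Prop where
  subset_vertices : ∀ S ∈ T, S ⊆ Icc 1 m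
  card_eq : ∀ S ∈ T, #S = δ + 1
  inter_eq : ∀ S ∈ T, ∀ S' ∈ T, hull δ S ∩ hull δ S' = hull δ (S ∩ S')
  cover : ⋃ S ∈ T, hull δ S = cyclicPolytope m δ

/-! ### The first order -/

/-- `|F|` is a lower facet of `C(X, δ + 1)`: it is spanned by `δ + 1` vertices and is the set
where a linear functional with positive last coefficient attains its minimum on the polytope
(so that it is seen from points with very large negative last coordinate). -/
def IsLowerFacet (δ : ℕ) (X F : Finset ℕ) : Prop :=
  F ⊆ X ∧ #F = δ + 1 ∧ ∃ l : (Fin (δ + 1) → ℝ) →ₗ[ℝ] ℝ,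
    0 < l (Pi.single (Fin.last δ) 1) ∧
    hull (δ + 1) F = {x ∈ hull (δ + 1) X | ∀ y ∈ hull (δ + 1) X, l x ≤ l y}

/-- `|F|` is an upper facet of `C(X, δ + 1)`: it is spanned by `δ + 1` vertices and is the set
where a linear functional with positive last coefficient attains its maximum on the polytope
(so that it is seen from points with very large positive last coordinate). -/
def IsUpperFacet (δ : ℕ) (X F : Finset ℕ) : Prop :=
  F ⊆ X ∧ #F = δ + 1 ∧ ∃ l : (Fin (δ + 1) → ℝ) →ₗ[ℝ] ℝ,
    0 < l (Pi.single (Fin.last δ) 1) ∧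
    hull (δ + 1) F = {x ∈ hull (δ + 1) X | ∀ y ∈ hull (δ + 1) X, l y ≤ l x}

/-- The lower triangulation of `C(X, δ)`, given by the lower facets of `C(X, δ + 1)`. -/
def lowerTriangulation (δ : ℕ) (X : Finset ℕ) : Set (Finset ℕ) := {F | IsLowerFacet δ X F}

/-- The upper triangulation of `C(X, δ)`, given by the upper facets of `C(X, δ + 1)`. -/
def upperTriangulation (δ : ℕ) (X : Finset ℕ) : Set (Finset ℕ) := {F | IsUpperFacet δ X F}

/-- The portion of `T` inside `C(X, δ)`. -/
def portion (δ : ℕ) (T : Set (Finset ℕ)) (X : Finset ℕ) : Set (Finset ℕ) :=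
  {S ∈ T | hull δ S ⊆ hull δ X}

/-- The covering relation `T ⋖₁ T'` of the first higher Stasheff–Tamari order: `T'` is an
increasing bistellar flip of `T`. That is, for some `(δ + 2)`-subset `X` of `[m]`, `T` restricts
to the lower triangulation of `C(X, δ)`, and `T'` is obtained by replacing the portion of `T`
inside `C(X, δ)` with the upper triangulation of `C(X, δ)`. -/
def IsIncreasingFlip (m δ : ℕ) (T T' : Set (Finset ℕ)) : Prop :=
  ∃ X : Finset ℕ, X ⊆ Icc 1 m ∧ #X = δ + 2 ∧
    portion δ T X = lowerTriangulation δ X ∧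
    T' = (T \ portion δ T X) ∪ upperTriangulation δ X

/-! ### The second order -/

/-- `y` is the image of `x` under the affine map that takes some simplex `|S|_δ ∋ x` of `T` to
`|S|_{δ + 1}` by sending vertices to vertices, in terms of barycentric coordinates. -/
def IsLift (δ : ℕ) (T : Set (Finset ℕ)) (x : Fin δ → ℝ) (y : Fin (δ + 1) → ℝ) : Prop :=
  ∃ S ∈ T, ∃ w : ℕ → ℝ, (∀ i ∈ S, 0 ≤ w i) ∧ ∑ i ∈ S, w i = 1 ∧
    ∑ i ∈ S, w i • momentCurve δ (i : ℝ) = x ∧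
    ∑ i ∈ S, w i • momentCurve (δ + 1) (i : ℝ) = y

open Classical in
/-- The piecewise-linear section `s_T : C(m, δ) → C(m, δ + 1)` defined by a triangulation `T`
of `C(m, δ)`. It is well defined by `existsUnique_isLift` below; outside `C(m, δ)` it has the
value `0`. -/
noncomputable def sectionMap (δ : ℕ) (T : Set (Finset ℕ)) (x : Fin δ → ℝ) : Fin (δ + 1) → ℝ :=
  if h : ∃ y, IsLift δ T x y then h.choose else 0

/-- The second higher Stasheff–Tamari order `T ≤₂ T'` on triangulations of `C(m, δ)`:
`s_T(x)_{δ + 1} ≤ s_{T'}(x)_{δ + 1}` for all `x ∈ C(m, δ)`. -/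
def SecondLE (m δ : ℕ) (T T' : Set (Finset ℕ)) : Prop :=
  ∀ x ∈ cyclicPolytope m δ,
    sectionMap δ T x (Fin.last δ) ≤ sectionMap δ T' x (Fin.last δ)

/-- A point of `|S|_δ` has barycentric coordinates. -/
theorem exists_weights {δ : ℕ} {S : Finset ℕ} {x : Fin δ → ℝ} (hx : x ∈ hull δ S) :
    ∃ w : ℕ → ℝ, (∀ i ∈ S, 0 ≤ w i) ∧ ∑ i ∈ S, w i = 1 ∧
      ∑ i ∈ S, w i • momentCurve δ (i : ℝ) = x := by
  classical
  have hsub : hull δ S ⊆ {x | ∃ w : ℕ → ℝ, (∀ i ∈ S, 0 ≤ w i) ∧ ∑ i ∈ S, w i = 1 ∧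
      ∑ i ∈ S, w i • momentCurve δ (i : ℝ) = x} := by
    apply convexHull_min
    · rintro _ ⟨j, hj, rfl⟩
      have hj' : j ∈ S := hj
      refine ⟨fun i => if i = j then 1 else 0, fun i _ => by dsimp only; split_ifs <;> norm_num,
        by simp [hj'], by simp [ite_smul, hj']⟩
    · rintro x ⟨v, hv0, hv1, hvx⟩ y ⟨w, hw0, hw1, hwy⟩ a b ha hb hab
      refine ⟨fun i => a * v i + b * w i, fun i hi => ?_, ?_, ?_⟩
      · have := hv0 i hi
        have := hw0 i hi
        positivity
      · rw [sum_add_distrib, ← mul_sum, ← mul_sum, hv1, hw1]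
        linarith
      · simp only [add_smul, mul_smul, sum_add_distrib, ← smul_sum, hvx, hwy]
  exact hsub hx

/-- Barycentric coordinates with respect to a `δ`-simplex are unique. -/
theorem weights_unique {δ : ℕ} {S : Finset ℕ} (hS : #S = δ + 1) {v w : ℕ → ℝ}
    (h1 : ∑ i ∈ S, v i = ∑ i ∈ S, w i)
    (h2 : ∑ i ∈ S, v i • momentCurve δ (i : ℝ) = ∑ i ∈ S, w i • momentCurve δ (i : ℝ)) :
    ∀ i ∈ S, v i = w i := by
  set g : Fin (δ + 1) ↪o ℕ := S.orderEmbOfFin hS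
  have hg : ∀ f : ℕ → ℝ, ∑ i ∈ S, f i = ∑ j, f (g j) := by
    intro f
    have himg : S = univ.map g.toEmbedding := (S.map_orderEmbOfFin_univ hS).symm
    conv_lhs => rw [himg, sum_map]
    rfl
  have hz : (fun j => v (g j) - w (g j)) = 0 := by
    apply Matrix.eq_zero_of_forall_pow_sum_mul_pow_eq_zero (f := fun j => ((g j : ℕ) : ℝ))
    · exact Nat.cast_injective.comp g.injective
    · intro k
      have key : ∑ i ∈ S, (v i - w i) * (i : ℝ) ^ (k : ℕ) = 0 := by
        rcases Fin.eq_zero_or_eq_succ k with rfl | ⟨j, rfl⟩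
        · simp [h1]
        · have := congrFun h2 j
          simp only [Finset.sum_apply, Pi.smul_apply, smul_eq_mul, momentCurve] at this
          simp only [sub_mul, sum_sub_distrib, Fin.val_succ, this, sub_self]
      rw [hg (fun i => (v i - w i) * (i : ℝ) ^ (k : ℕ))] at key
      exact key
  intro i hi
  obtain ⟨j, hj⟩ : i ∈ Set.range g := by rw [S.range_orderEmbOfFin hS]; exact hi
  have := congrFun hz j
  simp only [hj, Pi.zero_apply] at this
  linarith

/-- The section defined by a triangulation is well defined. -/
theorem existsUnique_isLift {m δ : ℕ} {T : Set (Finset ℕ)} (hT : IsTriangulation m δ T)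
    {x : Fin δ → ℝ} (hx : x ∈ cyclicPolytope m δ) : ∃! y, IsLift δ T x y := by
  classical
  rw [← hT.cover] at hx
  simp only [Set.mem_iUnion] at hx
  obtain ⟨S, hS, hxS⟩ := hx
  obtain ⟨w, hw0, hw1, hwx⟩ := exists_weights hxS
  refine ⟨_, ⟨S, hS, w, hw0, hw1, hwx, rfl⟩, ?_⟩
  rintro y ⟨S', hS', v, hv0, hv1, hvx, rfl⟩
  have hxS' : x ∈ hull δ S' := by
    rw [← hvx]
    exact (convex_convexHull ℝ _).sum_mem hv0 hv1
      fun i hi => subset_convexHull ℝ _ ⟨i, hi, rfl⟩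
  have hxI : x ∈ hull δ (S ∩ S') := hT.inter_eq S hS S' hS' ▸ ⟨hxS, hxS'⟩
  obtain ⟨u, -, hu1, hux⟩ := exists_weights hxI
  -- On each simplex containing `x`, the barycentric coordinates are those on the common face.
  have main : ∀ R ∈ T, S ∩ S' ⊆ R → ∀ c : ℕ → ℝ, ∑ i ∈ R, c i = 1 →
      ∑ i ∈ R, c i • momentCurve δ (i : ℝ) = x →
      ∑ i ∈ R, c i • momentCurve (δ + 1) (i : ℝ) =
        ∑ i ∈ S ∩ S', u i • momentCurve (δ + 1) (i : ℝ) := by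
    intro R hR hsub c hc1 hcx
    have ext : ∀ n, ∑ i ∈ R, (if i ∈ S ∩ S' then u i else 0) • momentCurve n (i : ℝ) =
        ∑ i ∈ S ∩ S', u i • momentCurve n (i : ℝ) := by
      intro n
      simp only [ite_smul, zero_smul]
      rw [← sum_filter, filter_mem_eq_inter, inter_eq_right.mpr hsub]
    have h := weights_unique (hT.card_eq R hR) (v := c)
      (w := fun i => if i ∈ S ∩ S' then u i else 0)
      (by rw [hc1, ← sum_filter, filter_mem_eq_inter, inter_eq_right.mpr hsub, hu1])
      (by rw [hcx, ext, hux])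
    rw [← ext]
    exact sum_congr rfl fun i hi => by rw [h i hi]
  rw [main S' hS' inter_subset_right v hv1 hvx, main S hS inter_subset_left w hw1 hwx]

/-! ### Intertwining tuples -/

/-- For `(d + 1)`-subsets `A = {a₀ < … < a_d}` and `B = {b₀ < … < b_d}`, the relation
`A ≀ B` (`A` intertwines `B`): `a₀ < b₀ < a₁ < b₁ < … < a_d < b_d`. -/
def Intertwines (d : ℕ) (A B : Finset ℕ) : Prop :=
  ∃ a b : Fin (d + 1) → ℕ, StrictMono a ∧ StrictMono b ∧
    Set.range a = (A : Set ℕ) ∧ Set.range b = (B : Set ℕ) ∧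
    (∀ i, a i < b i) ∧ ∀ i : Fin d, b i.castSucc < a i.succ

/-- The separated `(d + 1)`-tuples in `[m]`: those without two consecutive entries. -/
def separated (m d : ℕ) : Set (Finset ℕ) :=
  {A | A ⊆ Icc 1 m ∧ #A = d + 1 ∧ ∀ a ∈ A, ∀ b ∈ A, a < b → a + 2 ≤ b}

/-- The set `e(T)` encoding `T`, consisting of the separated `(d + 1)`-tuples that span a `d`-face of a simplex of `T`. -/
def tupleSet (m d : ℕ) (T : Set (Finset ℕ)) : Set (Finset ℕ) :=
  {A ∈ separated m d | ∃ S ∈ T, A ⊆ S}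

end CyclicPolytope

namespace CyclicPolytope

/-! Two weights on [m] represent the same point of ℝ^(2d) exactly when their difference `c` has
vanishing moments of orders 0, …, 2d. Both statements come from reading sign patterns of such `c`.
If the first nonvanishing moment has order n and is positive, then `c` has n + 1 alternating signs,
the last one positive; otherwise a monic polynomial of degree n would have sign opposite to `c`
everywhere, and pairing it with `c` would make this moment nonpositive. So each nonzero affine
dependence contains crossing tuples with opposite signs (`exists_crosses`). Conversely, crossing
tuples carry a circuit with these signs (`Intertwines.exists_circuit`).

It follows that faces of one triangulation never cross (`not_crosses`). For the second order, the
difference in height of the two sections at a point is the moment of order 2d + 1, and its sign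
decides which tuple intertwines the other.

For the first order, a flip in X = A ∪ B trades the simplices X \ b for the X \ a, which affects
only the tuples A and B. In the other direction, if the tuple sets differ only by A and B, then (A,
B) is the only crossing pair available. Expressing a point of a simplex of one triangulation in the
other then either changes nothing or subtracts a multiple of one circuit (`eq_smul_circuit`).
Well-chosen points show that simplices avoiding A survive (`mem_of_not_subset`) and that those
containing A are the X \ b (`erase_mem_of_subset`). -/

/-! ### Moments and sign changes -/

/-- A function with no long alternating sequence of values is matched by a monic polynomial. -/
theorem exists_alternating_or_monic (n : ℕ) : ∀ (c : ℕ → ℝ) (N : ℕ),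
    (∃ z : ℕ → ℕ, StrictAntiOn z (Set.Iic n) ∧ (∀ i ≤ n, 0 < (-1) ^ i * c (z i)) ∧ z 0 < N) ∨
    ∃ q : Polynomial ℝ, q.Monic ∧ q.natDegree = n ∧ (∀ i < N, c i * q.eval (i : ℝ) ≤ 0) ∧
      ∀ x : ℝ, (N : ℝ) ≤ x → 0 ≤ q.eval x := by
  induction n with
  | zero =>
    intro c N
    by_cases h : ∃ t < N, 0 < c t
    · obtain ⟨t, ht, hc⟩ := h
      refine Or.inl ⟨fun _ => t, ?_, ?_, ht⟩
      · intro i hi j hj hij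
        simp only [Set.mem_Iic] at hi hj
        omega
      · intro i hi
        obtain rfl : i = 0 := by omega
        simpa using hc
    · push Not at h
      exact Or.inr ⟨1, Polynomial.monic_one, by simp, by simpa using h, by simp⟩
  | succ n ih =>
    intro c N
    by_cases h : ∃ t < N, 0 < c t
    · obtain ⟨t, ht, hmax⟩ := ((range N).filter fun t => 0 < c t).exists_max_image id
        (by obtain ⟨t, ht, hc⟩ := h; exact ⟨t, by simp [ht, hc]⟩)
      simp only [mem_filter, mem_range, id] at ht hmax
      -- With `t` the largest index below `N` where `c` is positive, continue below `t` with the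
      -- opposite sign: `t` is either prepended to the sequence or becomes a new root of the
      -- polynomial.
      rcases ih (fun i => -c i) t with ⟨z, hz, hs, h0⟩ | ⟨q, hq, hdeg, hle, hpos⟩
      · refine Or.inl ⟨fun i => Nat.casesOn i t z, ?_, ?_, ht.1⟩
        · intro i hi j hj hij
          simp only [Set.mem_Iic] at hi hj
          obtain ⟨j, rfl⟩ : ∃ k, j = k + 1 := ⟨j - 1, by omega⟩
          have hj0 : z j ≤ z 0 := hz.antitoneOn (by simp) (by simp; omega) (Nat.zero_le j)
          rcases i with _ | i
          · exact lt_of_le_of_lt hj0 h0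
          · exact hz (by simp; omega) (by simp; omega) (by omega)
        · intro i hi
          rcases i with _ | i
          · simpa using ht.2
          · have := hs i (by omega)
            simp only [pow_succ]
            linarith
      · refine Or.inr ⟨q * (Polynomial.X - Polynomial.C (t : ℝ)),
          hq.mul (Polynomial.monic_X_sub_C _), ?_, ?_, ?_⟩
        · rw [hq.natDegree_mul (Polynomial.monic_X_sub_C _), hdeg, Polynomial.natDegree_X_sub_C]
        · intro i hi
          simp only [Polynomial.eval_mul, Polynomial.eval_sub, Polynomial.eval_X,
            Polynomial.eval_C]
          rcases lt_or_ge i t with hit | hit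
          · have h1 := hle i hit
            have h2 : (i : ℝ) - t ≤ 0 := by
              have : (i : ℝ) < t := by exact_mod_cast hit
              linarith
            nlinarith
          · have h2 : (t : ℝ) ≤ i := by exact_mod_cast hit
            rcases eq_or_lt_of_le hit with rfl | hlt
            · simp
            · have h3 : c i ≤ 0 := by
                by_contra hc
                have := hmax i ⟨hi, not_le.mp hc⟩
                omega
              exact mul_nonpos_of_nonpos_of_nonneg h3
                (mul_nonneg (hpos i h2) (sub_nonneg.mpr h2))
        · intro x hx
          have h1 : (t : ℝ) ≤ x := le_trans (by exact_mod_cast ht.1.le) hx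
          simp only [Polynomial.eval_mul, Polynomial.eval_sub, Polynomial.eval_X,
            Polynomial.eval_C]
          exact mul_nonneg (hpos x h1) (sub_nonneg.mpr h1)
    · push Not at h
      refine Or.inr ⟨Polynomial.X ^ (n + 1), Polynomial.monic_X_pow _, by simp, ?_, ?_⟩
      · intro i hi
        exact mul_nonpos_of_nonpos_of_nonneg (h i hi) (by simp)
      · intro x hx
        have : 0 ≤ x := le_trans (Nat.cast_nonneg _) hx
        simp only [Polynomial.eval_pow, Polynomial.eval_X]
        positivity

/-- If all moments below the degree of `q` vanish, only the leading term of `q` contributes. -/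
theorem sum_mul_eval_eq {M : Finset ℕ} {c : ℕ → ℝ} {n : ℕ}
    (h : ∀ k < n, ∑ i ∈ M, c i * (i : ℝ) ^ k = 0) {q : Polynomial ℝ} (hq : q.natDegree ≤ n) :
    ∑ i ∈ M, c i * q.eval (i : ℝ) = q.coeff n * ∑ i ∈ M, c i * (i : ℝ) ^ n := by
  have h1 : ∀ i ∈ M, c i * q.eval (i : ℝ) =
      ∑ k ∈ range (n + 1), q.coeff k * (c i * (i : ℝ) ^ k) := by
    intro i _
    rw [Polynomial.eval_eq_sum_range' (Nat.lt_succ_of_le hq), mul_sum]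
    exact sum_congr rfl fun k _ => by ring
  rw [sum_congr rfl h1, sum_comm]
  simp only [← mul_sum]
  rw [sum_range_succ, sum_eq_zero, zero_add]
  intro k hk
  rw [h k (mem_range.mp hk), mul_zero]

/-- Vanishing low moments force many sign changes. -/
theorem exists_alternating {M : Finset ℕ} {c : ℕ → ℝ} {n : ℕ}
    (h : ∀ k < n, ∑ i ∈ M, c i * (i : ℝ) ^ k = 0)
    (hn : 0 < ∑ i ∈ M, c i * (i : ℝ) ^ n) :
    ∃ z : ℕ → ℕ, StrictAntiOn z (Set.Iic n) ∧ ∀ i ≤ n, 0 < (-1) ^ i * c (z i) := by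
  rcases exists_alternating_or_monic n c (M.sup id + 1) with ⟨z, h1, h2, -⟩ | ⟨q, hq, hd, hle, -⟩
  · exact ⟨z, h1, h2⟩
  · have h1 := sum_mul_eval_eq h hd.le
    rw [← hd, hq.coeff_natDegree, hd, one_mul] at h1
    have h2 : ∑ i ∈ M, c i * q.eval (i : ℝ) ≤ 0 := by
      refine sum_nonpos fun i hi => hle i ?_
      exact Nat.lt_succ_of_le (le_sup (f := id) hi)
    linarith

/-- A finitely supported function with vanishing moments is zero. -/
theorem eq_zero_of_moments {M : Finset ℕ} {c : ℕ → ℝ} (hM : ∀ i ∉ M, c i = 0)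
    (h : ∀ k, ∑ i ∈ M, c i * (i : ℝ) ^ k = 0) : c = 0 := by
  by_contra hc
  obtain ⟨j, hj⟩ : ∃ j, c j ≠ 0 := by
    by_contra! hall
    exact hc (funext hall)
  have hjM : j ∈ M := by
    by_contra hn
    exact hj (hM j hn)
  -- Pairing with this polynomial isolates the value of `c` at `j`.
  set q : Polynomial ℝ := ∏ i ∈ M.erase j, (Polynomial.X - Polynomial.C (i : ℝ))
  have h1 := sum_mul_eval_eq (n := q.natDegree) (fun k _ => h k) le_rfl
  rw [h, mul_zero, sum_eq_single_of_mem j hjM] at h1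
  · rcases mul_eq_zero.mp h1 with h2 | h2
    · exact hj h2
    · simp only [q, Polynomial.eval_prod, Polynomial.eval_sub, Polynomial.eval_X,
        Polynomial.eval_C, prod_eq_zero_iff, mem_erase] at h2
      obtain ⟨i, hi, h3⟩ := h2
      exact hi.1 (by exact_mod_cast (sub_eq_zero.mp h3).symm)
  · intro i hi hij
    rw [Polynomial.eval_prod, prod_eq_zero (mem_erase.mpr ⟨hij, hi⟩) (by simp), mul_zero]

/-- An alternating sequence of `2 * d + 2` values gives a pair of intertwining tuples. -/
theorem intertwines_of_alternating {c : ℕ → ℝ} {d : ℕ} {z : ℕ → ℕ}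
    (hz : StrictAntiOn z (Set.Iic (2 * d + 1)))
    (hs : ∀ i ≤ 2 * d + 1, 0 < (-1) ^ i * c (z i)) :
    ∃ A B : Finset ℕ, Intertwines d A B ∧ (∀ a ∈ A, c a < 0) ∧ ∀ b ∈ B, 0 < c b := by
  have hlt : ∀ i j, i < j → j ≤ 2 * d + 1 → z j < z i := fun i j hij hj =>
    hz (Set.mem_Iic.mpr (by omega)) (Set.mem_Iic.mpr hj) hij
  -- `z` decreases and starts with a positive value, so the enumerations run backwards: odd places
  -- give the negative tuple, even places the positive one.
  set a : Fin (d + 1) → ℕ := fun k => z (2 * (d - k) + 1) with ha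
  set b : Fin (d + 1) → ℕ := fun k => z (2 * (d - k)) with hb
  refine ⟨univ.image a, univ.image b,
    ⟨a, b, ?_, ?_, by simp, by simp, ?_, ?_⟩, ?_, ?_⟩
  · intro i j hij
    have : (i : ℕ) < j := hij
    exact hlt _ _ (by omega) (by omega)
  · intro i j hij
    have : (i : ℕ) < j := hij
    exact hlt _ _ (by omega) (by omega)
  · intro i
    exact hlt _ _ (by omega) (by omega)
  · intro i
    refine hlt _ _ ?_ ?_ <;> simp <;> omega
  · simp only [mem_image, mem_univ, true_and, forall_exists_index, forall_apply_eq_imp_iff]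
    intro k
    have := hs (2 * (d - k) + 1) (by omega)
    simp only [pow_succ, pow_mul] at this
    norm_num at this
    exact this
  · simp only [mem_image, mem_univ, true_and, forall_exists_index, forall_apply_eq_imp_iff]
    intro k
    have := hs (2 * (d - k)) (by omega)
    simp only [pow_mul] at this
    norm_num at this
    exact this

/-! ### Crossing tuples and circuits -/

/-- One of two tuples intertwines the other. -/
def Crosses (d : ℕ) (A B : Finset ℕ) : Prop := Intertwines d A B ∨ Intertwines d B A

theorem Crosses.symm {d : ℕ} {A B : Finset ℕ} (h : Crosses d A B) : Crosses d B A := Or.symm h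

/-- An affine dependence of points of the moment curve contains a pair of crossing tuples. -/
theorem exists_crosses {M : Finset ℕ} {c : ℕ → ℝ} {d : ℕ} (hM : ∀ i ∉ M, c i = 0)
    (h : ∀ k < 2 * d + 1, ∑ i ∈ M, c i * (i : ℝ) ^ k = 0) (hc : c ≠ 0) :
    ∃ A B : Finset ℕ, Crosses d A B ∧ (∀ a ∈ A, 0 < c a) ∧ ∀ b ∈ B, c b < 0 := by
  classical
  have hex : ∃ k, ∑ i ∈ M, c i * (i : ℝ) ^ k ≠ 0 := by
    by_contra! hall
    exact hc (eq_zero_of_moments hM hall)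
  set n := Nat.find hex with hn
  have hlow : ∀ k < n, ∑ i ∈ M, c i * (i : ℝ) ^ k = 0 := fun k hk =>
    not_not.mp (Nat.find_min hex hk)
  have hdn : 2 * d + 1 ≤ n := by
    by_contra! hlt
    exact Nat.find_spec hex (h _ hlt)
  -- Only the 2d + 2 largest places of the alternating sequence are kept.
  have restrict : ∀ z : ℕ → ℕ, StrictAntiOn z (Set.Iic n) →
      StrictAntiOn z (Set.Iic (2 * d + 1)) := fun z hz => hz.mono (Set.Iic_subset_Iic.mpr hdn)
  rcases lt_or_gt_of_ne (Nat.find_spec hex) with hneg | hpos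
  · obtain ⟨z, hz, hs⟩ := exists_alternating (M := M) (c := fun i => -c i) (n := n)
      (fun k hk => by simp [hlow k hk])
      (by simp only [neg_mul, sum_neg_distrib]; linarith)
    obtain ⟨A, B, hAB, hA, hB⟩ := intertwines_of_alternating (c := fun i => -c i)
      (restrict z hz) fun i hi => hs i (hi.trans hdn)
    exact ⟨A, B, Or.inl hAB, fun a ha => by simpa using hA a ha, fun b hb => by simpa using hB b hb⟩
  · obtain ⟨z, hz, hs⟩ := exists_alternating hlow hpos
    obtain ⟨A, B, hAB, hA, hB⟩ := intertwines_of_alternating (restrict z hz)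
      fun i hi => hs i (hi.trans hdn)
    exact ⟨B, A, Or.inr hAB, hB, hA⟩

theorem lt_of_intertwined {d : ℕ} {a b : Fin (d + 1) → ℕ} (hb : StrictMono b)
    (h : ∀ i : Fin d, b i.castSucc < a i.succ) {i j : Fin (d + 1)} (hij : j < i) : b j < a i := by
  obtain ⟨k, rfl⟩ := Fin.exists_succ_eq.mpr (Fin.ne_zero_of_lt hij)
  refine lt_of_le_of_lt (hb.monotone ?_) (h k)
  exact Fin.le_castSucc_iff.mpr hij

/-- Ordered enumerations of two intertwining tuples. -/
theorem Intertwines.exists_enum {d : ℕ} {A B : Finset ℕ} (h : Intertwines d A B) :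
    ∃ a b : Fin (d + 1) → ℕ, StrictMono a ∧ StrictMono b ∧ A = univ.image a ∧ B = univ.image b ∧
      (∀ i j, i ≤ j → a i < b j) ∧ ∀ i j, j < i → b j < a i := by
  obtain ⟨a, b, ha, hb, hA, hB, h1, h2⟩ := h
  refine ⟨a, b, ha, hb, ?_, ?_, fun i j hij => (h1 i).trans_le (hb.monotone hij),
    fun i j hij => lt_of_intertwined hb h2 hij⟩
  · exact coe_injective (by simp [hA])
  · exact coe_injective (by simp [hB])

theorem Intertwines.card_left {d : ℕ} {A B : Finset ℕ} (h : Intertwines d A B) : #A = d + 1 := by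
  obtain ⟨a, b, ha, hb, rfl, rfl, -⟩ := h.exists_enum
  simp [card_image_of_injective _ ha.injective]

theorem Intertwines.card_right {d : ℕ} {A B : Finset ℕ} (h : Intertwines d A B) : #B = d + 1 := by
  obtain ⟨a, b, ha, hb, rfl, rfl, -⟩ := h.exists_enum
  simp [card_image_of_injective _ hb.injective]

theorem Intertwines.disjoint {d : ℕ} {A B : Finset ℕ} (h : Intertwines d A B) : Disjoint A B := by
  obtain ⟨a, b, ha, hb, rfl, rfl, h1, h2⟩ := h.exists_enum
  simp only [disjoint_left, mem_image, mem_univ, true_and, not_exists, forall_exists_index,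
    forall_apply_eq_imp_iff]
  intro i j hij
  rcases le_or_gt i j with h | h
  · exact (h1 i j h).ne' hij
  · exact (h2 i j h).ne hij

theorem Intertwines.separated_left {d : ℕ} {A B : Finset ℕ} (h : Intertwines d A B) :
    ∀ x ∈ A, ∀ y ∈ A, x < y → x + 2 ≤ y := by
  obtain ⟨a, b, ha, hb, rfl, rfl, h1, h2⟩ := h.exists_enum
  simp only [mem_image, mem_univ, true_and, forall_exists_index, forall_apply_eq_imp_iff]
  intro i j hij
  have := h1 i i le_rfl
  have := h2 j i (ha.lt_iff_lt.mp hij)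
  omega

theorem Intertwines.separated_right {d : ℕ} {A B : Finset ℕ} (h : Intertwines d A B) :
    ∀ x ∈ B, ∀ y ∈ B, x < y → x + 2 ≤ y := by
  obtain ⟨a, b, ha, hb, rfl, rfl, h1, h2⟩ := h.exists_enum
  simp only [mem_image, mem_univ, true_and, forall_exists_index, forall_apply_eq_imp_iff]
  intro i j hij
  have := h1 j j le_rfl
  have := h2 j i (hb.lt_iff_lt.mp hij)
  omega

theorem Crosses.card_left {d : ℕ} {A B : Finset ℕ} (h : Crosses d A B) : #A = d + 1 :=
  h.elim Intertwines.card_left Intertwines.card_right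

theorem Crosses.disjoint {d : ℕ} {A B : Finset ℕ} (h : Crosses d A B) : Disjoint A B :=
  h.elim Intertwines.disjoint fun h => h.disjoint.symm

theorem Crosses.card_union {d : ℕ} {A B : Finset ℕ} (h : Crosses d A B) :
    #(A ∪ B) = 2 * d + 2 := by
  rw [card_union_of_disjoint h.disjoint, h.card_left, h.symm.card_left]
  omega

theorem Crosses.mem_separated {d m : ℕ} {A B : Finset ℕ} (h : Crosses d A B) (hA : A ⊆ Icc 1 m) :
    A ∈ separated m d :=
  ⟨hA, h.card_left, h.elim Intertwines.separated_left Intertwines.separated_right⟩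

/-- The affine dependence of the points of the moment curve over two intertwining tuples. -/
theorem Intertwines.exists_circuit {d : ℕ} {A B : Finset ℕ} (h : Intertwines d A B) :
    ∃ c : ℕ → ℝ, (∀ i ∉ A ∪ B, c i = 0) ∧ (∀ a ∈ A, c a < 0) ∧ (∀ b ∈ B, 0 < c b) ∧
      (∀ k < 2 * d + 1, ∑ i ∈ A ∪ B, c i * (i : ℝ) ^ k = 0) ∧
      ∑ i ∈ A ∪ B, c i * (i : ℝ) ^ (2 * d + 1) = 1 := by
  classical
  have hcard := Crosses.card_union (Or.inl h)
  have hdis := h.disjoint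
  -- The inverses of these products are the coefficients of the divided difference over A ∪ B, which
  -- reads off the coefficient of degree 2d + 1.
  set w : ℕ → ℝ := fun i => ∏ j ∈ (A ∪ B).erase i, ((i : ℝ) - j) with hw
  have hsum : ∀ k < 2 * d + 2, ∑ i ∈ A ∪ B, (w i)⁻¹ * (i : ℝ) ^ k =
      if k = 2 * d + 1 then 1 else 0 := by
    intro k hk
    have h1 := Lagrange.coeff_eq_sum (s := A ∪ B) (v := fun i : ℕ => (i : ℝ))
      Nat.cast_injective.injOn (P := Polynomial.X ^ k)
      (by rw [Polynomial.degree_X_pow, hcard]; exact_mod_cast hk)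
    rw [hcard, Polynomial.coeff_X_pow] at h1
    simp only [Polynomial.eval_pow, Polynomial.eval_X] at h1
    have h2 : (if 2 * d + 2 - 1 = k then (1 : ℝ) else 0) = if k = 2 * d + 1 then 1 else 0 := by
      congr 1
      exact propext ⟨by omega, by omega⟩
    rw [← h2, h1]
    exact sum_congr rfl fun i _ => by rw [div_eq_mul_inv, mul_comm]
  have hc : ∀ k, ∑ i ∈ A ∪ B, (if i ∈ A ∪ B then (w i)⁻¹ else 0) * (i : ℝ) ^ k =
      ∑ i ∈ A ∪ B, (w i)⁻¹ * (i : ℝ) ^ k := fun k =>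
    sum_congr rfl fun i hi => by rw [if_pos hi]
  obtain ⟨a, b, ha, hb, rfl, rfl, h1, h2⟩ := h.exists_enum
  refine ⟨fun i => if i ∈ univ.image a ∪ univ.image b then (w i)⁻¹ else 0,
    fun i hi => if_neg hi, ?_, ?_, ?_, ?_⟩
  · intro x hx
    dsimp only
    rw [if_pos (mem_union_left _ hx), inv_lt_zero]
    simp only [mem_image, mem_univ, true_and] at hx
    obtain ⟨i, rfl⟩ := hx
    have hnot : a i ∉ univ.image b := disjoint_left.mp hdis (mem_image_of_mem _ (mem_univ _))
    simp only [hw]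
    rw [erase_union_distrib, erase_eq_of_notMem hnot, prod_union (hdis.mono_left (erase_subset _ _)),
      ← image_erase ha.injective, prod_image ha.injective.injOn, prod_image hb.injective.injOn,
      ← mul_prod_erase univ _ (mem_univ i), mul_left_comm, ← prod_mul_distrib]
    -- For j ≠ i, `a j` and `b j` lie on the same side of `a i`, so their factors have positive
    -- product; only the factor of `b i` determines the sign.
    refine mul_neg_of_neg_of_pos ?_ (prod_pos fun j hj => ?_)
    · have := h1 i i le_rfl
      rw [sub_neg]
      exact_mod_cast this
    · rcases lt_or_gt_of_ne (ne_of_mem_erase hj) with hji | hij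
      · have e1 : (a j : ℝ) < a i := by exact_mod_cast ha hji
        have e2 : (b j : ℝ) < a i := by exact_mod_cast h2 i j hji
        exact mul_pos (sub_pos.mpr e1) (sub_pos.mpr e2)
      · have e1 : (a i : ℝ) < a j := by exact_mod_cast ha hij
        have e2 : (a i : ℝ) < b j := by exact_mod_cast h1 i j hij.le
        exact mul_pos_of_neg_of_neg (sub_neg.mpr e1) (sub_neg.mpr e2)
  · intro x hx
    dsimp only
    rw [if_pos (mem_union_right _ hx), inv_pos]
    simp only [mem_image, mem_univ, true_and] at hx
    obtain ⟨i, rfl⟩ := hx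
    have hnot : b i ∉ univ.image a := disjoint_right.mp hdis (mem_image_of_mem _ (mem_univ _))
    simp only [hw]
    rw [erase_union_distrib, erase_eq_of_notMem hnot, prod_union (hdis.mono_right (erase_subset _ _)),
      ← image_erase hb.injective, prod_image ha.injective.injOn, prod_image hb.injective.injOn,
      ← mul_prod_erase univ _ (mem_univ i), mul_assoc, ← prod_mul_distrib]
    refine mul_pos ?_ (prod_pos fun j hj => ?_)
    · have := h1 i i le_rfl
      rw [sub_pos]
      exact_mod_cast this
    · rcases lt_or_gt_of_ne (ne_of_mem_erase hj) with hji | hij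
      · have e1 : (a j : ℝ) < b i := by exact_mod_cast h1 j i hji.le
        have e2 : (b j : ℝ) < b i := by exact_mod_cast hb hji
        exact mul_pos (sub_pos.mpr e1) (sub_pos.mpr e2)
      · have e1 : (b i : ℝ) < a j := by exact_mod_cast h2 j i hij
        have e2 : (b i : ℝ) < b j := by exact_mod_cast hb hij
        exact mul_pos_of_neg_of_neg (sub_neg.mpr e1) (sub_neg.mpr e2)
  · intro k hk
    rw [hc, hsum k (by omega), if_neg (by omega)]
  · rw [hc, hsum _ (by omega), if_pos rfl]

theorem sum_mul_eq_of_subset {S M : Finset ℕ} (h : S ⊆ M) {c : ℕ → ℝ} (hc : ∀ i ∉ S, c i = 0)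
    (f : ℕ → ℝ) : ∑ i ∈ M, c i * f i = ∑ i ∈ S, c i * f i :=
  (sum_subset h fun i _ hi => by rw [hc i hi, zero_mul]).symm

/-- The affine dependence over two crossing tuples, positive on the first one. -/
theorem Crosses.exists_circuit {d : ℕ} {A B M : Finset ℕ} (h : Crosses d A B) (hM : A ∪ B ⊆ M) :
    ∃ c : ℕ → ℝ, (∀ i ∉ A ∪ B, c i = 0) ∧ (∀ a ∈ A, 0 < c a) ∧ (∀ b ∈ B, c b < 0) ∧
      ∀ k < 2 * d + 1, ∑ i ∈ M, c i * (i : ℝ) ^ k = 0 := by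
  rcases h with h | h
  · obtain ⟨c, h0, hA, hB, hs, -⟩ := h.exists_circuit
    refine ⟨fun i => -c i, fun i hi => by simp [h0 i hi], fun a ha => by simpa using hA a ha,
      fun b hb => by simpa using hB b hb, fun k hk => ?_⟩
    simp only [neg_mul, sum_neg_distrib]
    rw [sum_mul_eq_of_subset hM h0 fun i => (i : ℝ) ^ k, hs k hk, neg_zero]
  · obtain ⟨c, h0, hB, hA, hs, -⟩ := h.exists_circuit
    rw [union_comm] at h0 hs
    refine ⟨c, h0, hA, hB, fun k hk => ?_⟩
    rw [sum_mul_eq_of_subset hM h0 fun i => (i : ℝ) ^ k, hs k hk]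

/-- An affine dependence that contains only one pair of crossing tuples is a multiple of the
circuit over this pair. -/
theorem eq_smul_circuit {d : ℕ} {A B M : Finset ℕ} {c l : ℕ → ℝ}
    (hc : ∀ i ∉ M, c i = 0) (hc0 : c ≠ 0)
    (hcs : ∀ k < 2 * d + 1, ∑ i ∈ M, c i * (i : ℝ) ^ k = 0)
    (hsub : A ∪ B ⊆ M) (hl : ∀ i ∉ A ∪ B, l i = 0) (hlA : ∀ a ∈ A, 0 < l a)
    (hlB : ∀ b ∈ B, l b < 0) (hls : ∀ k < 2 * d + 1, ∑ i ∈ M, l i * (i : ℝ) ^ k = 0)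
    (huniq : ∀ A' B', Crosses d A' B' → (∀ a ∈ A', 0 < c a) → (∀ b ∈ B', c b < 0) →
      A' = A ∧ B' = B) :
    ∃ t : ℝ, 0 < t ∧ ∀ i, c i = t * l i := by
  obtain ⟨A₁, B₁, hcr, hA, hB⟩ := exists_crosses hc hcs hc0
  obtain ⟨rfl, rfl⟩ := huniq A₁ B₁ hcr hA hB
  have hne : (A₁ ∪ B₁).Nonempty := by
    rw [← card_pos, hcr.card_union]
    omega
  -- With the smallest ratio `t`, subtracting `t * l` from `c` reverses no sign and kills the entry
  -- at `j`. A nonzero remainder would contain a crossing pair, necessarily the same one, although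
  -- it vanishes at `j`.
  obtain ⟨j, hj, hmin⟩ := (A₁ ∪ B₁).exists_min_image (fun i => c i / l i) hne
  set t := c j / l j with ht
  have hlj : l j ≠ 0 := by
    rcases mem_union.mp hj with h | h
    · exact (hlA j h).ne'
    · exact (hlB j h).ne
  have htpos : 0 < t := by
    rcases mem_union.mp hj with h | h
    · exact div_pos (hA j h) (hlA j h)
    · exact div_pos_of_neg_of_neg (hB j h) (hlB j h)
  refine ⟨t, htpos, ?_⟩
  by_contra hcon
  have hne0 : (fun i => c i - t * l i) ≠ 0 := by
    intro h0
    exact hcon fun i => by have := congrFun h0 i; simp only [Pi.zero_apply] at this; linarith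
  obtain ⟨A₂, B₂, hcr₂, hA₂, hB₂⟩ := exists_crosses (M := M) (d := d)
    (fun i hi => by rw [hc i hi, hl i fun h => hi (hsub h)]; ring)
    (fun k hk => by
      simp only [sub_mul, sum_sub_distrib, mul_assoc, ← mul_sum, hcs k hk, hls k hk]
      ring) hne0
  have key := huniq A₂ B₂ hcr₂
    (fun i hi => by
      have h1 := hA₂ i hi
      by_cases hiA : i ∈ A₁
      · exact hA i hiA
      by_cases hiB : i ∈ B₁
      · have h2 := hmin i (mem_union_right _ hiB)
        rw [le_div_iff_of_neg (hlB i hiB)] at h2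
        linarith
      · rw [hl i (by simp [hiA, hiB])] at h1
        linarith)
    (fun i hi => by
      have h1 := hB₂ i hi
      by_cases hiB : i ∈ B₁
      · exact hB i hiB
      by_cases hiA : i ∈ A₁
      · have h2 := hmin i (mem_union_left _ hiA)
        rw [le_div_iff₀ (hlA i hiA)] at h2
        linarith
      · rw [hl i (by simp [hiA, hiB])] at h1
        linarith)
  have hz : c j - t * l j = 0 := by
    rw [ht, div_mul_cancel₀ _ hlj, sub_self]
  rw [key.1] at hA₂
  rw [key.2] at hB₂
  rcases mem_union.mp hj with h | h
  · have := hA₂ j h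
    linarith
  · have := hB₂ j h
    linarith

/-! ### Weights and moments -/

/-- The total mass is the moment of order 0, and the coordinates are those of orders 1, …, δ. -/
theorem sum_smul_momentCurve_eq_iff {δ : ℕ} {S S' : Finset ℕ} {v w : ℕ → ℝ} :
    (∑ i ∈ S, w i = ∑ i ∈ S', v i ∧
      ∑ i ∈ S, w i • momentCurve δ (i : ℝ) = ∑ i ∈ S', v i • momentCurve δ (i : ℝ)) ↔
    ∀ k < δ + 1, ∑ i ∈ S, w i * (i : ℝ) ^ k = ∑ i ∈ S', v i * (i : ℝ) ^ k := by
  constructor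
  · rintro ⟨h0, h1⟩ k hk
    rcases k with _ | k
    · simpa using h0
    · have := congrFun h1 ⟨k, by omega⟩
      simpa [Finset.sum_apply, momentCurve] using this
  · intro h
    refine ⟨by simpa using h 0 (by omega), funext fun k => ?_⟩
    simpa [Finset.sum_apply, momentCurve] using h (k + 1) (by omega)

theorem mem_hull_of_weights {δ : ℕ} {S : Finset ℕ} {w : ℕ → ℝ} (h0 : ∀ i ∈ S, 0 ≤ w i)
    (h1 : ∑ i ∈ S, w i = 1) : ∑ i ∈ S, w i • momentCurve δ (i : ℝ) ∈ hull δ S :=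
  (convex_convexHull ℝ _).sum_mem h0 h1 fun i hi => subset_convexHull ℝ _ ⟨i, hi, rfl⟩

theorem hull_mono {δ : ℕ} {S S' : Finset ℕ} (h : S ⊆ S') : hull δ S ⊆ hull δ S' :=
  convexHull_mono (Set.image_mono (coe_subset.mpr h))

/-- Barycentric coordinates extended by zero. -/
theorem exists_weights_zero_off {δ : ℕ} {S : Finset ℕ} {x : Fin δ → ℝ} (hx : x ∈ hull δ S) :
    ∃ w : ℕ → ℝ, (∀ i, 0 ≤ w i) ∧ (∀ i ∉ S, w i = 0) ∧ ∑ i ∈ S, w i = 1 ∧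
      ∑ i ∈ S, w i • momentCurve δ (i : ℝ) = x := by
  classical
  obtain ⟨w, h0, h1, h2⟩ := exists_weights hx
  refine ⟨fun i => if i ∈ S then w i else 0, fun i => ?_, fun i hi => if_neg hi, ?_, ?_⟩
  · dsimp only
    split_ifs with h
    exacts [h0 i h, le_rfl]
  · rw [← h1]
    exact sum_congr rfl fun i hi => if_pos hi
  · rw [← h2]
    exact sum_congr rfl fun i hi => by dsimp only; rw [if_pos hi]

theorem sum_weight_mul_eq {S M : Finset ℕ} (h : S ⊆ M) {c : ℕ → ℝ} (hc : ∀ i ∉ S, c i = 0)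
    {δ : ℕ} (f : ℕ → Fin δ → ℝ) : ∑ i ∈ M, c i • f i = ∑ i ∈ S, c i • f i :=
  (sum_subset h fun i _ hi => by rw [hc i hi, zero_smul]).symm

/-! ### Weights on the simplices of a triangulation -/

namespace IsTriangulation

variable {m δ : ℕ} {T : Set (Finset ℕ)}

/-- Any nonnegative weight on `[m]` can be pushed to a simplex of the triangulation. -/
theorem exists_mem_weights (hT : IsTriangulation m δ T) {w : ℕ → ℝ} (hw : ∀ i, 0 ≤ w i)
    (hwM : ∀ i ∉ Icc 1 m, w i = 0) (hne : ∃ i, 0 < w i) :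
    ∃ S ∈ T, ∃ v : ℕ → ℝ, (∀ i, 0 ≤ v i) ∧ (∀ i ∉ S, v i = 0) ∧
      ∀ k < δ + 1, ∑ i ∈ Icc 1 m, v i * (i : ℝ) ^ k = ∑ i ∈ Icc 1 m, w i * (i : ℝ) ^ k := by
  obtain ⟨j, hj⟩ := hne
  have hjM : j ∈ Icc 1 m := by
    by_contra h
    exact hj.ne' (hwM j h)
  set s := ∑ i ∈ Icc 1 m, w i
  have hs : 0 < s := lt_of_lt_of_le hj (single_le_sum (fun i _ => hw i) hjM)
  have hmem := mem_hull_of_weights (δ := δ) (S := Icc 1 m) (w := fun i => w i / s)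
    (fun i _ => div_nonneg (hw i) hs.le) (by rw [← sum_div, div_self hs.ne'])
  have hcov := hT.cover
  rw [cyclicPolytope] at hcov
  rw [← hcov] at hmem
  simp only [Set.mem_iUnion] at hmem
  obtain ⟨S, hS, hx⟩ := hmem
  obtain ⟨v, hv0, hvS, hv1, hvx⟩ := exists_weights_zero_off hx
  refine ⟨S, hS, fun i => s * v i, fun i => mul_nonneg hs.le (hv0 i),
    fun i hi => by simp [hvS i hi], fun k hk => ?_⟩
  have hsub := hT.subset_vertices S hS
  have key := (sum_smul_momentCurve_eq_iff (δ := δ) (S := Icc 1 m) (S' := S)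
    (w := fun i => w i / s) (v := v)).mp
    ⟨by rw [hv1, ← sum_div, div_self hs.ne'], hvx.symm⟩ k hk
  rw [← sum_mul_eq_of_subset hsub hvS] at key
  simp only [mul_assoc, ← mul_sum, ← key]
  rw [mul_sum]
  exact sum_congr rfl fun i _ => by field_simp

/-- Weights on two simplices of a triangulation that represent the same point agree. -/
theorem weights_eq (hT : IsTriangulation m δ T) {S S' : Finset ℕ} (hS : S ∈ T) (hS' : S' ∈ T)
    {w v : ℕ → ℝ} (hw : ∀ i, 0 ≤ w i) (hwS : ∀ i ∉ S, w i = 0) (hv : ∀ i, 0 ≤ v i)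
    (hvS : ∀ i ∉ S', v i = 0)
    (h : ∀ k < δ + 1, ∑ i ∈ Icc 1 m, v i * (i : ℝ) ^ k = ∑ i ∈ Icc 1 m, w i * (i : ℝ) ^ k) :
    w = v := by
  classical
  have hsub := hT.subset_vertices S hS
  have hsub' := hT.subset_vertices S' hS'
  have hsums : ∀ k < δ + 1, ∑ i ∈ S', v i * (i : ℝ) ^ k = ∑ i ∈ S, w i * (i : ℝ) ^ k := by
    intro k hk
    rw [← sum_mul_eq_of_subset hsub hwS, ← sum_mul_eq_of_subset hsub' hvS, h k hk]
  obtain ⟨h0, h1⟩ := sum_smul_momentCurve_eq_iff.mpr hsums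
  set s := ∑ i ∈ S, w i
  -- Weights of total mass 0 cannot be normalised to barycentric coordinates, but they vanish.
  rcases (sum_nonneg fun i _ => hw i : 0 ≤ s).eq_or_lt with hs | hs
  · funext i
    have e1 : w i = 0 := by
      by_cases hi : i ∈ S
      · exact (sum_eq_zero_iff_of_nonneg fun i _ => hw i).mp hs.symm i hi
      · exact hwS i hi
    have e2 : v i = 0 := by
      by_cases hi : i ∈ S'
      · exact (sum_eq_zero_iff_of_nonneg fun i _ => hv i).mp (h0.trans hs.symm) i hi
      · exact hvS i hi
    rw [e1, e2]
  · have hs0 : s ≠ 0 := hs.ne'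
    have hx := mem_hull_of_weights (δ := δ) (S := S) (w := fun i => w i / s)
      (fun i _ => div_nonneg (hw i) hs.le) (by rw [← sum_div, div_self hs.ne'])
    have hx' := mem_hull_of_weights (δ := δ) (S := S') (w := fun i => v i / s)
      (fun i _ => div_nonneg (hv i) hs.le) (by rw [← sum_div, h0, div_self hs.ne'])
    have heq : ∑ i ∈ S', (v i / s) • momentCurve δ (i : ℝ) =
        ∑ i ∈ S, (w i / s) • momentCurve δ (i : ℝ) := by
      simp only [div_eq_inv_mul, mul_smul, ← smul_sum, h1]
    rw [heq] at hx'
    have hxx : _ ∈ hull δ S ∩ hull δ S' := ⟨hx, hx'⟩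
    rw [hT.inter_eq S hS S' hS'] at hxx
    obtain ⟨u, -, hu, hu1, hux⟩ := exists_weights_zero_off hxx
    have main : ∀ R ∈ T, S ∩ S' ⊆ R → ∀ c : ℕ → ℝ, (∀ i ∉ R, c i = 0) → ∑ i ∈ R, c i = s →
        ∑ i ∈ R, (c i / s) • momentCurve δ (i : ℝ) =
          ∑ i ∈ S, (w i / s) • momentCurve δ (i : ℝ) → ∀ i, c i = s * u i := by
      intro R hR hRsub c hc hc1 hcx i
      by_cases hi : i ∈ R
      · have := weights_unique (hT.card_eq R hR) (v := fun i => c i / s) (w := u)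
          (by
            rw [← sum_div, hc1, div_self hs.ne', ← hu1]
            exact sum_subset hRsub fun i _ hi => hu i hi)
          (by rw [hcx, ← hux, sum_weight_mul_eq hRsub hu]) i hi
        rw [← this]
        field_simp
      · rw [hc i hi, hu i fun h => hi (hRsub h), mul_zero]
    funext i
    rw [main S hS inter_subset_left w hwS rfl rfl i, main S' hS' inter_subset_right v hvS h0 heq i]

/-- Faces of a triangulation do not cross. -/
theorem not_crosses {d : ℕ} (hT : IsTriangulation m (2 * d) T) {S S' A B : Finset ℕ} (hS : S ∈ T)
    (hS' : S' ∈ T) (hA : A ⊆ S) (hB : B ⊆ S') : ¬ Crosses d A B := by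
  classical
  intro h
  obtain ⟨l, h0, hlA, hlB, hs⟩ := h.exists_circuit (union_subset
    (hA.trans (hT.subset_vertices S hS)) (hB.trans (hT.subset_vertices S' hS')))
  -- The positive and negative parts of the circuit represent the same point, up to a common scale,
  -- on the two simplices, so they would have to coincide.
  have key := hT.weights_eq hS hS' (w := fun i => max (l i) 0) (v := fun i => max (-l i) 0)
    (fun i => le_max_right _ _)
    (fun i hi => max_eq_right (by
      by_cases hiB : i ∈ B
      · exact (hlB i hiB).le
      · exact (h0 i (by simp [hiB]; exact fun h => hi (hA h))).le))
    (fun i => le_max_right _ _)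
    (fun i hi => max_eq_right (by
      by_cases hiA : i ∈ A
      · have := hlA i hiA
        linarith
      · rw [h0 i (by simp [hiA]; exact fun h => hi (hB h)), neg_zero]))
    (fun k hk => by
      rw [eq_comm, ← sub_eq_zero, ← sum_sub_distrib]
      refine (sum_congr rfl fun i _ => ?_).trans (hs k hk)
      rw [← sub_mul]
      congr 1
      rcases le_total (l i) 0 with hi | hi
      · rw [max_eq_right hi, max_eq_left (by linarith)]
        ring
      · rw [max_eq_left hi, max_eq_right (by linarith)]
        ring)
  obtain ⟨a, ha⟩ : A.Nonempty := by
    rw [← card_pos, h.card_left]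
    omega
  have h1 := congrFun key a
  have h2 := hlA a ha
  rw [max_eq_left h2.le, max_eq_right (by linarith)] at h1
  linarith

/-- Separation is automatic for a tuple in a crossing pair: an entry of the other tuple lies between
any two of its entries. -/
theorem mem_tupleSet {d : ℕ} (hT : IsTriangulation m (2 * d) T) {S A B : Finset ℕ} (hS : S ∈ T)
    (hA : A ⊆ S) (h : Crosses d A B) : A ∈ tupleSet m d T :=
  ⟨h.mem_separated (hA.trans (hT.subset_vertices S hS)), S, hS, hA⟩

theorem sectionMap_eq (hT : IsTriangulation m δ T) {S : Finset ℕ} (hS : S ∈ T) {w : ℕ → ℝ}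
    (hw : ∀ i ∈ S, 0 ≤ w i) (hw1 : ∑ i ∈ S, w i = 1) :
    sectionMap δ T (∑ i ∈ S, w i • momentCurve δ (i : ℝ)) (Fin.last δ) =
      ∑ i ∈ S, w i * (i : ℝ) ^ (δ + 1) := by
  have hlift : IsLift δ T (∑ i ∈ S, w i • momentCurve δ (i : ℝ))
      (∑ i ∈ S, w i • momentCurve (δ + 1) (i : ℝ)) := ⟨S, hS, w, hw, hw1, rfl, rfl⟩
  have hx : ∑ i ∈ S, w i • momentCurve δ (i : ℝ) ∈ cyclicPolytope m δ := by
    rw [← hT.cover]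
    exact Set.mem_biUnion hS (mem_hull_of_weights hw hw1)
  have hex : ∃ y, IsLift δ T (∑ i ∈ S, w i • momentCurve δ (i : ℝ)) y := ⟨_, hlift⟩
  rw [sectionMap, dif_pos hex, (existsUnique_isLift hT hx).unique hex.choose_spec hlift]
  simp [Finset.sum_apply, momentCurve]

theorem exists_sectionMap_eq (hT : IsTriangulation m δ T) {x : Fin δ → ℝ}
    (hx : x ∈ cyclicPolytope m δ) : ∃ S ∈ T, ∃ w : ℕ → ℝ, (∀ i, 0 ≤ w i) ∧ (∀ i ∉ S, w i = 0) ∧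
      ∑ i ∈ S, w i = 1 ∧ ∑ i ∈ S, w i • momentCurve δ (i : ℝ) = x ∧
      sectionMap δ T x (Fin.last δ) = ∑ i ∈ Icc 1 m, w i * (i : ℝ) ^ (δ + 1) := by
  rw [← hT.cover] at hx
  simp only [Set.mem_iUnion] at hx
  obtain ⟨S, hS, hx⟩ := hx
  obtain ⟨w, h0, hwS, h1, rfl⟩ := exists_weights_zero_off hx
  refine ⟨S, hS, w, h0, hwS, h1, rfl, ?_⟩
  rw [hT.sectionMap_eq hS (fun i _ => h0 i) h1,
    sum_mul_eq_of_subset (hT.subset_vertices S hS) hwS]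

end IsTriangulation

/-! ### The second order -/

/-- An intertwining pair gives a common point of its two simplices where the circuit compares the
heights. Conversely, a point where the heights are in the wrong order gives a dependence with
positive moment of order 2d + 1, hence an intertwining pair. -/
theorem secondLE_iff {m d : ℕ} {T T' : Set (Finset ℕ)}
    (hT : IsTriangulation m (2 * d) T) (hT' : IsTriangulation m (2 * d) T') :
    SecondLE m (2 * d) T T' ↔
      ∀ A ∈ tupleSet m d T, ¬ ∃ B ∈ tupleSet m d T', Intertwines d B A := by
  classical
  constructor
  · rintro hle A ⟨-, S, hS, hAS⟩ ⟨B, ⟨-, S', hS', hBS⟩, h⟩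
    obtain ⟨l, h0, hlB, hlA, hs, htop⟩ := h.exists_circuit
    have hdis := h.disjoint
    rw [union_comm] at h0 hs htop
    rw [sum_union hdis.symm] at htop
    simp only [sum_union hdis.symm] at hs
    set s := ∑ i ∈ A, l i with hsdef
    have hspos : 0 < s := sum_pos hlA (by rw [← card_pos, h.card_right]; omega)
    set w : ℕ → ℝ := fun i => if i ∈ A then l i / s else 0 with hw
    set v : ℕ → ℝ := fun i => if i ∈ B then -l i / s else 0 with hv
    have hwsum : ∀ k, ∑ i ∈ S, w i * (i : ℝ) ^ k = (∑ i ∈ A, l i * (i : ℝ) ^ k) / s := by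
      intro k
      rw [sum_mul_eq_of_subset hAS fun i hi => if_neg hi, sum_div]
      exact sum_congr rfl fun i hi => by simp only [if_pos hi]; ring
    have hvsum : ∀ k, ∑ i ∈ S', v i * (i : ℝ) ^ k = -(∑ i ∈ B, l i * (i : ℝ) ^ k) / s := by
      intro k
      rw [sum_mul_eq_of_subset hBS fun i hi => if_neg hi, ← sum_neg_distrib, sum_div]
      exact sum_congr rfl fun i hi => by simp only [if_pos hi]; ring
    have heq : ∀ k < 2 * d + 1, ∑ i ∈ S, w i * (i : ℝ) ^ k = ∑ i ∈ S', v i * (i : ℝ) ^ k := by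
      intro k hk
      rw [hwsum, hvsum, eq_neg_of_add_eq_zero_left (hs k hk)]
    have hw0 : ∀ i ∈ S, 0 ≤ w i := by
      intro i _
      simp only [hw]
      split_ifs with hi
      exacts [(div_pos (hlA i hi) hspos).le, le_rfl]
    have hv0 : ∀ i ∈ S', 0 ≤ v i := by
      intro i _
      simp only [hv]
      split_ifs with hi
      exacts [(div_pos (neg_pos.mpr (hlB i hi)) hspos).le, le_rfl]
    have hw1 : ∑ i ∈ S, w i = 1 := by
      have := hwsum 0
      simp only [pow_zero, mul_one] at this
      rw [this, div_self hspos.ne']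
    obtain ⟨e1, e2⟩ := sum_smul_momentCurve_eq_iff.mpr heq
    have hx : ∑ i ∈ S, w i • momentCurve (2 * d) (i : ℝ) ∈ cyclicPolytope m (2 * d) := by
      rw [← hT.cover]
      exact Set.mem_biUnion hS (mem_hull_of_weights hw0 hw1)
    -- At the common point, the height over A exceeds that over B by 1/s, since the circuit has top
    -- moment 1.
    have h1 := hle _ hx
    rw [hT.sectionMap_eq hS hw0 hw1, e2, hT'.sectionMap_eq hS' hv0 (e1 ▸ hw1), hwsum, hvsum,
      div_le_div_iff_of_pos_right hspos] at h1
    linarith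
  · intro h x hx
    by_contra! hlt
    obtain ⟨S, hS, w, hw0, hwS, hw1, hwx, hwe⟩ := hT.exists_sectionMap_eq hx
    obtain ⟨S', hS', v, hv0, hvS, hv1, hvx, hve⟩ := hT'.exists_sectionMap_eq hx
    rw [hwe, hve] at hlt
    have heq := sum_smul_momentCurve_eq_iff.mp ⟨hw1.trans hv1.symm, hwx.trans hvx.symm⟩
    obtain ⟨z, hz, hs⟩ := exists_alternating (M := Icc 1 m) (c := fun i => w i - v i)
      (n := 2 * d + 1)
      (fun k hk => by
        simp only [sub_mul, sum_sub_distrib]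
        rw [sum_mul_eq_of_subset (hT.subset_vertices S hS) hwS,
          sum_mul_eq_of_subset (hT'.subset_vertices S' hS') hvS, heq k hk, sub_self])
      (by simp only [sub_mul, sum_sub_distrib]; linarith)
    obtain ⟨B, A, hBA, hB, hA⟩ := intertwines_of_alternating (c := fun i => w i - v i) hz hs
    have hAS : A ⊆ S := fun i hi => by
      by_contra hn
      have h1 := hA i hi
      have h2 := hv0 i
      rw [hwS i hn] at h1
      linarith
    have hBS : B ⊆ S' := fun i hi => by
      by_contra hn
      have h1 := hB i hi
      have h2 := hw0 i
      rw [hvS i hn] at h1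
      linarith
    exact h A (hT.mem_tupleSet hS hAS (Or.inr hBA))
      ⟨B, hT'.mem_tupleSet hS' hBS (Or.inl hBA), hBA⟩

/-! ### Lower and upper facets -/

/-- The points of the moment curve are in convex position. -/
theorem mem_of_momentCurve_mem_hull {δ : ℕ} (hδ : 2 ≤ δ) {S : Finset ℕ} {j : ℕ}
    (h : momentCurve δ (j : ℝ) ∈ hull δ S) : j ∈ S := by
  obtain ⟨w, h0, h1, h2⟩ := exists_weights h
  have e1 := congrFun h2 ⟨0, by omega⟩
  have e2 := congrFun h2 ⟨1, by omega⟩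
  simp only [Finset.sum_apply, Pi.smul_apply, smul_eq_mul, momentCurve] at e1 e2
  norm_num at e1 e2
  -- The function (t - j)² is nonnegative and vanishes only at `j`; its weighted sum involves only
  -- moments up to order 2.
  have hz : ∑ i ∈ S, w i * ((i : ℝ) - j) ^ 2 = 0 := by
    have : ∀ i ∈ S, w i * ((i : ℝ) - j) ^ 2 =
        w i * (i : ℝ) ^ 2 - 2 * j * (w i * i) + (j : ℝ) ^ 2 * w i := fun i _ => by ring
    rw [sum_congr rfl this, sum_add_distrib, sum_sub_distrib, ← mul_sum, ← mul_sum, e1, e2, h1]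
    ring
  rw [sum_eq_zero_iff_of_nonneg fun i hi => mul_nonneg (h0 i hi) (sq_nonneg _)] at hz
  by_contra hj
  have : ∑ i ∈ S, w i = 0 := sum_eq_zero fun i hi => by
    rcases mul_eq_zero.mp (hz i hi) with h | h
    · exact h
    · have h3 : (i : ℝ) = j := sub_eq_zero.mp (pow_eq_zero_iff (two_ne_zero)|>.mp h)
      exact absurd (by exact_mod_cast h3 : i = j) fun h => hj (h ▸ hi)
  linarith

/-- A functional that is constant on all vertices but one exposes the facet they span. -/
theorem hull_erase_eq_argmin {δ : ℕ} {X : Finset ℕ} {x : ℕ} (hx : x ∈ X)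
    (hne : (X.erase x).Nonempty) {g : (Fin δ → ℝ) →ₗ[ℝ] ℝ} {μ : ℝ}
    (hF : ∀ i ∈ X.erase x, g (momentCurve δ (i : ℝ)) = μ) (hgx : μ < g (momentCurve δ (x : ℝ))) :
    hull δ (X.erase x) = {y ∈ hull δ X | ∀ z ∈ hull δ X, g y ≤ g z} := by
  have hval : ∀ w : ℕ → ℝ, ∑ i ∈ X, w i = 1 → g (∑ i ∈ X, w i • momentCurve δ (i : ℝ)) =
      μ + w x * (g (momentCurve δ (x : ℝ)) - μ) := by
    intro w hw
    rw [← add_sum_erase X _ hx] at hw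
    rw [map_sum, ← add_sum_erase X _ hx]
    simp only [map_smul, smul_eq_mul]
    rw [sum_congr rfl fun i hi => by rw [hF i hi], ← sum_mul, eq_sub_of_add_eq' hw]
    ring
  have hge : ∀ z ∈ hull δ X, μ ≤ g z := by
    intro z hz
    obtain ⟨w, h0, h1, rfl⟩ := exists_weights hz
    rw [hval w h1]
    have := mul_nonneg (h0 x hx) (sub_pos.mpr hgx).le
    linarith
  ext y
  constructor
  · intro hy
    refine ⟨hull_mono (erase_subset _ _) hy, fun z hz => ?_⟩
    obtain ⟨w, h0, h1, rfl⟩ := exists_weights hy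
    have : g (∑ i ∈ X.erase x, w i • momentCurve δ (i : ℝ)) = μ := by
      rw [map_sum]
      simp only [map_smul, smul_eq_mul]
      rw [sum_congr rfl fun i hi => by rw [hF i hi], ← sum_mul, h1, one_mul]
    rw [this]
    exact hge z hz
  · rintro ⟨hy, hmin⟩
    obtain ⟨w, h0, h1, rfl⟩ := exists_weights hy
    obtain ⟨f, hf⟩ := hne
    have h2 := hmin _ (subset_convexHull ℝ _ ⟨f, mem_of_mem_erase hf, rfl⟩)
    rw [hF f hf, hval w h1] at h2
    have hwx : w x = 0 := by
      have hpos := sub_pos.mpr hgx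
      have := h0 x hx
      by_contra hne
      have := mul_pos (lt_of_le_of_ne this (Ne.symm hne)) hpos
      linarith
    rw [← add_sum_erase X _ hx, hwx, zero_smul, zero_add]
    rw [← add_sum_erase X _ hx, hwx, zero_add] at h1
    exact mem_hull_of_weights (fun i hi => h0 i (mem_of_mem_erase hi)) h1

/-- The value of a functional on the affine dependence of the points one dimension lower. -/
theorem sum_circuit_mul_apply {δ : ℕ} {X : Finset ℕ} {c : ℕ → ℝ}
    (h : ∀ k < δ + 1, ∑ i ∈ X, c i * (i : ℝ) ^ k = 0) (h1 : ∑ i ∈ X, c i * (i : ℝ) ^ (δ + 1) = 1)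
    (g : (Fin (δ + 1) → ℝ) →ₗ[ℝ] ℝ) :
    ∑ i ∈ X, c i * g (momentCurve (δ + 1) (i : ℝ)) = g (Pi.single (Fin.last δ) 1) := by
  have : ∑ i ∈ X, c i • momentCurve (δ + 1) (i : ℝ) = Pi.single (Fin.last δ) 1 := by
    ext k
    simp only [Finset.sum_apply, Pi.smul_apply, smul_eq_mul, momentCurve]
    refine Fin.lastCases ?_ (fun k => ?_) k
    · simpa using h1
    · rw [Pi.single_eq_of_ne (Fin.castSucc_lt_last k).ne]
      exact h _ (by simp)
  rw [← this, map_sum]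
  simp

/-- The coefficient of the circuit at the vertex opposite to an exposed facet. -/
theorem exists_pos_mul_eq_of_argmin {δ : ℕ} (hδ : 1 ≤ δ) {X : Finset ℕ} {c : ℕ → ℝ}
    (h : ∀ k < δ + 1, ∑ i ∈ X, c i * (i : ℝ) ^ k = 0) (h1 : ∑ i ∈ X, c i * (i : ℝ) ^ (δ + 1) = 1)
    {x : ℕ} (hx : x ∈ X) (hne : (X.erase x).Nonempty) (g : (Fin (δ + 1) → ℝ) →ₗ[ℝ] ℝ)
    (hF : hull (δ + 1) (X.erase x) =
      {y ∈ hull (δ + 1) X | ∀ z ∈ hull (δ + 1) X, g y ≤ g z}) :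
    ∃ γ : ℝ, 0 < γ ∧ c x * γ = g (Pi.single (Fin.last δ) 1) := by
  obtain ⟨f, hf⟩ := hne
  have hvert : ∀ i ∈ X, momentCurve (δ + 1) (i : ℝ) ∈ hull (δ + 1) X := fun i hi =>
    subset_convexHull ℝ _ ⟨i, hi, rfl⟩
  have hmin : ∀ i ∈ X.erase x, ∀ z ∈ hull (δ + 1) X, g (momentCurve (δ + 1) (i : ℝ)) ≤ g z := by
    intro i hi
    have : momentCurve (δ + 1) (i : ℝ) ∈ hull (δ + 1) (X.erase x) :=
      subset_convexHull ℝ _ ⟨i, hi, rfl⟩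
    rw [hF] at this
    exact this.2
  have hconst : ∀ i ∈ X.erase x,
      g (momentCurve (δ + 1) (i : ℝ)) = g (momentCurve (δ + 1) (f : ℝ)) := fun i hi =>
    le_antisymm (hmin i hi _ (hvert f (mem_of_mem_erase hf)))
      (hmin f hf _ (hvert i (mem_of_mem_erase hi)))
  have hlt : g (momentCurve (δ + 1) (f : ℝ)) < g (momentCurve (δ + 1) (x : ℝ)) := by
    by_contra! hle
    have : momentCurve (δ + 1) (x : ℝ) ∈ hull (δ + 1) (X.erase x) := by
      rw [hF]
      exact ⟨hvert x hx, fun z hz => hle.trans (hmin f hf z hz)⟩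
    exact notMem_erase x X (mem_of_momentCurve_mem_hull (by omega) this)
  refine ⟨_, sub_pos.mpr hlt, ?_⟩
  have h0 : ∑ i ∈ X, c i = 0 := by simpa using h 0 (by omega)
  rw [← sum_circuit_mul_apply h h1 g, ← add_sum_erase X _ hx,
    sum_congr rfl fun i hi => by rw [hconst i hi], ← sum_mul]
  rw [← add_sum_erase X _ hx] at h0
  rw [eq_neg_of_add_eq_zero_right h0]
  ring

/-- The functional of a monic polynomial vanishing on all but one vertex. -/
theorem exists_linearMap_erase {δ : ℕ} {X : Finset ℕ} {c : ℕ → ℝ} (hX : #X = δ + 2)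
    (h : ∀ k < δ + 1, ∑ i ∈ X, c i * (i : ℝ) ^ k = 0) (h1 : ∑ i ∈ X, c i * (i : ℝ) ^ (δ + 1) = 1)
    {x : ℕ} (hx : x ∈ X) :
    ∃ (g : (Fin (δ + 1) → ℝ) →ₗ[ℝ] ℝ) (μ : ℝ), g (Pi.single (Fin.last δ) 1) = 1 ∧
      (∀ i ∈ X.erase x, g (momentCurve (δ + 1) (i : ℝ)) = μ) ∧
      c x * (g (momentCurve (δ + 1) (x : ℝ)) - μ) = 1 := by
  set q : Polynomial ℝ := ∏ i ∈ X.erase x, (Polynomial.X - Polynomial.C (i : ℝ)) with hq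
  have hdeg : q.natDegree = δ + 1 := by
    rw [hq, Polynomial.natDegree_finsetProd_X_sub_C_eq_card, card_erase_of_mem hx, hX]
    rfl
  have hmonic : q.Monic := Polynomial.monic_prod_X_sub_C _ _
  have hlead : q.coeff (δ + 1) = 1 := hdeg ▸ hmonic.coeff_natDegree
  -- On the moment curve this functional is `q` without its constant term, which explains the value
  -- `-q.coeff 0` of `μ` below.
  set g : (Fin (δ + 1) → ℝ) →ₗ[ℝ] ℝ :=
    ∑ k : Fin (δ + 1), q.coeff (k + 1) • LinearMap.proj k with hg
  have happly : ∀ v, g v = ∑ k : Fin (δ + 1), q.coeff (k + 1) * v k := by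
    intro v
    simp [hg, LinearMap.sum_apply]
  have hcurve : ∀ t : ℝ, g (momentCurve (δ + 1) t) = q.eval t - q.coeff 0 := by
    intro t
    rw [happly, Polynomial.eval_eq_sum_range' (n := δ + 2) (by omega),
      sum_range_succ', ← Fin.sum_univ_eq_sum_range (fun k => q.coeff (k + 1) * t ^ (k + 1))]
    simp [momentCurve]
  have hzero : ∀ i ∈ X.erase x, q.eval (i : ℝ) = 0 := by
    intro i hi
    rw [hq, Polynomial.eval_prod]
    exact prod_eq_zero hi (by simp)
  refine ⟨g, -q.coeff 0, ?_, fun i hi => ?_, ?_⟩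
  · rw [happly, sum_eq_single (Fin.last δ) (fun k _ hk => by simp [Pi.single_eq_of_ne hk])
      (by simp)]
    simp [hlead]
  · rw [hcurve, hzero i hi, zero_sub]
  · have := sum_mul_eval_eq h hdeg.le
    rw [h1, hlead, ← add_sum_erase X _ hx,
      sum_eq_zero (s := X.erase x) fun i hi => by rw [hzero i hi, mul_zero]] at this
    rw [hcurve]
    linarith

theorem exists_eq_erase {F X : Finset ℕ} (h : F ⊆ X) (hc : #X = #F + 1) :
    ∃ x ∈ X, F = X.erase x := by
  obtain ⟨x, hx⟩ := card_eq_one.mp (by rw [card_sdiff_of_subset h]; omega : #(X \ F) = 1)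
  have hxm : x ∈ X \ F := by simp [hx]
  refine ⟨x, (mem_sdiff.mp hxm).1, eq_of_subset_of_card_le
    (subset_erase.mpr ⟨h, (mem_sdiff.mp hxm).2⟩) ?_⟩
  rw [card_erase_of_mem (mem_sdiff.mp hxm).1]
  omega

/-- Lifted by one dimension, the circuit sums to the vertical unit vector. Pairing it with the
functional of a facet shows that the facet is lower exactly when the circuit is positive at the
opposite vertex. -/
theorem isLowerFacet_iff {d : ℕ} (hd : 1 ≤ d) {A B F : Finset ℕ} (h : Intertwines d A B) :
    IsLowerFacet (2 * d) (A ∪ B) F ↔ ∃ b ∈ B, F = (A ∪ B).erase b := by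
  have hcard := Crosses.card_union (Or.inl h)
  obtain ⟨c, -, hA, hB, hs, htop⟩ := h.exists_circuit
  have hne : ∀ x ∈ A ∪ B, ((A ∪ B).erase x).Nonempty := fun x hx => by
    rw [← card_pos, card_erase_of_mem hx]
    omega
  constructor
  · rintro ⟨hF, hFc, l, hl, hmin⟩
    obtain ⟨x, hx, rfl⟩ := exists_eq_erase hF (by omega)
    obtain ⟨γ, hγ, he⟩ := exists_pos_mul_eq_of_argmin (by omega) hs htop hx (hne x hx) l hmin
    rw [← he] at hl
    refine ⟨x, (mem_union.mp hx).resolve_left fun hxA => ?_, rfl⟩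
    nlinarith [hA x hxA]
  · rintro ⟨b, hb, rfl⟩
    have hx := mem_union_right A hb
    obtain ⟨g, μ, hg, hF, hc⟩ := exists_linearMap_erase hcard hs htop hx
    refine ⟨erase_subset _ _, by rw [card_erase_of_mem hx, hcard]; rfl, g, by rw [hg]; exact one_pos,
      hull_erase_eq_argmin hx (hne b hx) hF ?_⟩
    nlinarith [hB b hb]

theorem isUpperFacet_iff {d : ℕ} (hd : 1 ≤ d) {A B F : Finset ℕ} (h : Intertwines d A B) :
    IsUpperFacet (2 * d) (A ∪ B) F ↔ ∃ a ∈ A, F = (A ∪ B).erase a := by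
  have hcard := Crosses.card_union (Or.inl h)
  obtain ⟨c, -, hA, hB, hs, htop⟩ := h.exists_circuit
  have hne : ∀ x ∈ A ∪ B, ((A ∪ B).erase x).Nonempty := fun x hx => by
    rw [← card_pos, card_erase_of_mem hx]
    omega
  constructor
  · rintro ⟨hF, hFc, l, hl, hmax⟩
    obtain ⟨x, hx, rfl⟩ := exists_eq_erase hF (by omega)
    obtain ⟨γ, hγ, he⟩ := exists_pos_mul_eq_of_argmin (by omega) hs htop hx (hne x hx) (-l)
      (by simpa using hmax)
    rw [LinearMap.neg_apply] at he
    refine ⟨x, (mem_union.mp hx).resolve_right fun hxB => ?_, rfl⟩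
    nlinarith [hB x hxB]
  · rintro ⟨a, ha, rfl⟩
    have hx := mem_union_left B ha
    obtain ⟨g, μ, hg, hF, hc⟩ := exists_linearMap_erase hcard hs htop hx
    refine ⟨erase_subset _ _, by rw [card_erase_of_mem hx, hcard]; rfl, g, by rw [hg]; exact one_pos, ?_⟩
    have := hull_erase_eq_argmin hx (hne a hx) (g := -g) (μ := -μ)
      (fun i hi => by rw [LinearMap.neg_apply, hF i hi])
      (by rw [LinearMap.neg_apply]; nlinarith [hA a ha])
    simpa using this

/-- Every set of `2 * d + 2` vertices is the union of two intertwining tuples. -/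
theorem exists_intertwines_of_card {d : ℕ} {X : Finset ℕ} (hX : #X = 2 * d + 2) :
    ∃ A B, Intertwines d A B ∧ X = A ∪ B := by
  set e := X.orderEmbOfFin hX
  set a : Fin (d + 1) → ℕ := fun k => e ⟨2 * k, by omega⟩
  set b : Fin (d + 1) → ℕ := fun k => e ⟨2 * k + 1, by omega⟩
  have hI : Intertwines d (univ.image a) (univ.image b) := by
    refine ⟨a, b, fun i j hij => ?_, fun i j hij => ?_, by simp, by simp, fun i => ?_, fun i => ?_⟩
    all_goals
      refine e.strictMono ?_
      simp only [Fin.lt_def, Fin.val_succ, Fin.val_castSucc] at *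
      omega
  refine ⟨_, _, hI, (eq_of_subset_of_card_le ?_ ?_).symm⟩
  · intro x hx
    simp only [mem_union, mem_image, mem_univ, true_and] at hx
    rcases hx with ⟨k, rfl⟩ | ⟨k, rfl⟩ <;> exact orderEmbOfFin_mem X hX _
  · rw [Crosses.card_union (Or.inl hI), hX]

/-! ### The effect of a flip on the tuples -/

/-- A tuple in a lower facet of A ∪ B, if different from A, misses an element of A and so lies in an
upper facet; likewise with the roles exchanged. Hence only A and B are affected. -/
theorem tupleSet_of_isIncreasingFlip {m d : ℕ} (hd : 1 ≤ d) {T T' : Set (Finset ℕ)}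
    (hT' : IsTriangulation m (2 * d) T')
    (h : IsIncreasingFlip m (2 * d) T T') :
    ∃ (U : Set (Finset ℕ)) (A B : Finset ℕ),
      tupleSet m d T = U ∪ {A} ∧ tupleSet m d T' = U ∪ {B} ∧ Intertwines d A B := by
  obtain ⟨X, hXm, hX, hlow, hup⟩ := h
  obtain ⟨A, B, hI, rfl⟩ := exists_intertwines_of_card hX
  have hdis := hI.disjoint
  have hlow' : ∀ b ∈ B, (A ∪ B).erase b ∈ T := fun b hb =>
    (hlow ▸ (isLowerFacet_iff hd hI).mpr ⟨b, hb, rfl⟩ :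
      (A ∪ B).erase b ∈ portion (2 * d) T (A ∪ B)).1
  have hup' : ∀ a ∈ A, (A ∪ B).erase a ∈ T' := fun a ha => by
    rw [hup]
    exact Or.inr ((isUpperFacet_iff hd hI).mpr ⟨a, ha, rfl⟩)
  have hAsub : ∀ b ∈ B, A ⊆ (A ∪ B).erase b := fun b hb =>
    subset_erase.mpr ⟨subset_union_left, disjoint_right.mp hdis hb⟩
  have hBsub : ∀ a ∈ A, B ⊆ (A ∪ B).erase a := fun a ha =>
    subset_erase.mpr ⟨subset_union_right, disjoint_left.mp hdis ha⟩
  obtain ⟨a₀, ha₀⟩ : A.Nonempty := by rw [← card_pos, hI.card_left]; omega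
  obtain ⟨b₀, hb₀⟩ : B.Nonempty := by rw [← card_pos, hI.card_right]; omega
  have hsepA : A ∈ separated m d :=
    Crosses.mem_separated (Or.inl hI) (subset_union_left.trans hXm)
  have hsepB : B ∈ separated m d :=
    Crosses.mem_separated (Or.inr hI) (subset_union_right.trans hXm)
  have hmiss : ∀ F G : Finset ℕ, #F = d + 1 → #G = d + 1 → F ≠ G → ∃ g ∈ G, g ∉ F := by
    intro F G hF hG hne
    by_contra! hsub
    exact hne (eq_of_subset_of_card_le hsub (by omega)).symm
  refine ⟨tupleSet m d T \ {A}, A, B, ?_, ?_, hI⟩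
  · rw [Set.sdiff_union_self, Set.union_eq_self_of_subset_right]
    rw [Set.singleton_subset_iff]
    exact ⟨hsepA, _, hlow' b₀ hb₀, hAsub b₀ hb₀⟩
  · ext F
    constructor
    · rintro ⟨hFs, S, hS, hFS⟩
      by_cases hFB : F = B
      · exact Or.inr hFB
      have hS2 := hS
      rw [hup] at hS2
      rcases hS2 with hS2 | hS2
      · refine Or.inl ⟨⟨hFs, S, hS2.1, hFS⟩, ?_⟩
        rintro rfl
        exact hT'.not_crosses hS (hup' a₀ ha₀) hFS (hBsub a₀ ha₀) (Or.inl hI)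
      · obtain ⟨a, ha, rfl⟩ := (isUpperFacet_iff hd hI).mp hS2
        obtain ⟨b, hb, hbF⟩ := hmiss F B hFs.2.1 hI.card_right hFB
        refine Or.inl ⟨⟨hFs, _, hlow' b hb,
          subset_erase.mpr ⟨hFS.trans (erase_subset _ _), hbF⟩⟩, ?_⟩
        rintro rfl
        exact notMem_erase a _ (hFS ha)
    · rintro (⟨⟨hFs, S, hS, hFS⟩, hFA⟩ | rfl)
      · refine ⟨hFs, ?_⟩
        by_cases hp : S ∈ portion (2 * d) T (A ∪ B)
        · rw [hlow] at hp
          obtain ⟨b, hb, rfl⟩ := (isLowerFacet_iff hd hI).mp hp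
          obtain ⟨a, ha, haF⟩ := hmiss F A hFs.2.1 hI.card_left hFA
          exact ⟨_, hup' a ha, subset_erase.mpr ⟨hFS.trans (erase_subset _ _), haF⟩⟩
        · refine ⟨S, ?_, hFS⟩
          rw [hup]
          exact Or.inl ⟨hS, hp⟩
      · exact ⟨hsepB, _, hup' a₀ ha₀, hBsub a₀ ha₀⟩

/-! ### Recovering a flip from an exchange of tuples -/

section Exchange

variable {m d : ℕ} {T T' U : Set (Finset ℕ)} {A B : Finset ℕ}

/-- A common tuple of both triangulations crosses no tuple of either one. -/
theorem eq_of_crosses_of_tupleSet (hT : IsTriangulation m (2 * d) T)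
    (hT' : IsTriangulation m (2 * d) T') (hA : tupleSet m d T = U ∪ {A})
    (hB : tupleSet m d T' = U ∪ {B}) {F G : Finset ℕ} (hF : F ∈ tupleSet m d T)
    (hG : G ∈ tupleSet m d T') (h : Crosses d F G) : F = A ∧ G = B := by
  constructor
  · rw [hA] at hF
    refine hF.resolve_left fun hFU => ?_
    have hF' : F ∈ tupleSet m d T' := hB ▸ Or.inl hFU
    obtain ⟨-, S, hS, hFS⟩ := hF'
    obtain ⟨-, S', hS', hGS⟩ := hG
    exact hT'.not_crosses hS hS' hFS hGS h
  · rw [hB] at hG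
    refine hG.resolve_left fun hGU => ?_
    have hG' : G ∈ tupleSet m d T := hA ▸ Or.inl hGU
    obtain ⟨-, S, hS, hFS⟩ := hF
    obtain ⟨-, S', hS', hGS⟩ := hG'
    exact hT.not_crosses hS hS' hFS hGS h

/-- Crossing tuples in the difference of weights on two triangulations. -/
theorem eq_of_crosses_of_weights (hT : IsTriangulation m (2 * d) T)
    (hT' : IsTriangulation m (2 * d) T') (hA : tupleSet m d T = U ∪ {A})
    (hB : tupleSet m d T' = U ∪ {B}) {S S' : Finset ℕ} (hS : S ∈ T) (hS' : S' ∈ T')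
    {w v : ℕ → ℝ} (hw : ∀ i, 0 ≤ w i) (hwS : ∀ i ∉ S, w i = 0) (hv : ∀ i, 0 ≤ v i)
    (hvS : ∀ i ∉ S', v i = 0) {F G : Finset ℕ} (h : Crosses d F G)
    (hF : ∀ i ∈ F, 0 < w i - v i) (hG : ∀ i ∈ G, w i - v i < 0) :
    (F = A ∧ G = B) ∧ F ⊆ S ∧ G ⊆ S' := by
  have hFS : F ⊆ S := fun i hi => by
    by_contra hn
    have h1 := hF i hi
    have h2 := hv i
    rw [hwS i hn] at h1
    linarith
  have hGS : G ⊆ S' := fun i hi => by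
    by_contra hn
    have h1 := hG i hi
    have h2 := hw i
    rw [hvS i hn] at h1
    linarith
  exact ⟨eq_of_crosses_of_tupleSet hT hT' hA hB (hT.mem_tupleSet hS hFS h)
    (hT'.mem_tupleSet hS' hGS h.symm) h, hFS, hGS⟩

/-- Simplices that avoid the exchanged tuple are common to both triangulations. -/
theorem mem_of_not_subset (hT : IsTriangulation m (2 * d) T)
    (hT' : IsTriangulation m (2 * d) T') (hA : tupleSet m d T = U ∪ {A})
    (hB : tupleSet m d T' = U ∪ {B}) {S : Finset ℕ} (hS : S ∈ T) (hAS : ¬ A ⊆ S) : S ∈ T' := by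
  classical
  have hsub := hT.subset_vertices S hS
  have hcard := hT.card_eq S hS
  -- Up to scale, this is the barycentre of S; positivity on all of S makes equal weights force S ⊆
  -- S'.
  set w : ℕ → ℝ := fun i => if i ∈ S then 1 else 0 with hw
  have hw0 : ∀ i, 0 ≤ w i := fun i => by
    simp only [hw]
    split_ifs <;> norm_num
  have hwS : ∀ i ∉ S, w i = 0 := fun i hi => if_neg hi
  obtain ⟨j, hj⟩ : S.Nonempty := by rw [← card_pos]; omega
  obtain ⟨S', hS', v, hv0, hvS, hs⟩ := hT'.exists_mem_weights hw0
    (fun i hi => hwS i fun h => hi (hsub h)) ⟨j, by simp [hw, hj]⟩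
  have hsub' := hT'.subset_vertices S' hS'
  by_cases heq : (fun i => w i - v i) = 0
  · have hSS : S ⊆ S' := fun i hi => by
      by_contra hn
      have := congrFun heq i
      simp [hw, hi, hvS i hn] at this
    rwa [eq_of_subset_of_card_le hSS (by rw [hT'.card_eq S' hS', hcard])]
  · obtain ⟨F, G, hFG, hF, hG⟩ := exists_crosses (M := Icc 1 m) (d := d)
      (fun i hi => by rw [hwS i fun h => hi (hsub h), hvS i fun h => hi (hsub' h), sub_zero])
      (fun k hk => by simp only [sub_mul, sum_sub_distrib, hs k hk, sub_self]) heq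
    obtain ⟨⟨rfl, -⟩, hFS, -⟩ :=
      eq_of_crosses_of_weights hT hT' hA hB hS hS' hw0 hwS hv0 hvS hFG hF hG
    exact absurd hFS hAS

/-- A simplex through the exchanged tuple is a facet of the simplex spanned by both tuples, and
the opposite facets belong to the other triangulation. -/
theorem erase_mem_of_subset (hT : IsTriangulation m (2 * d) T)
    (hT' : IsTriangulation m (2 * d) T') (hA : tupleSet m d T = U ∪ {A})
    (hB : tupleSet m d T' = U ∪ {B}) (h : Crosses d A B) {S : Finset ℕ} (hS : S ∈ T)
    (hAS : A ⊆ S) {a : ℕ} (ha : a ∈ A) :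
    (A ∪ B).erase a ∈ T' ∧ ∃ b ∈ B, S = (A ∪ B).erase b := by
  classical
  have hsub := hT.subset_vertices S hS
  have hcard := hT.card_eq S hS
  have hBmem : B ∈ tupleSet m d T' := hB ▸ Or.inr rfl
  obtain ⟨hBsep, S₁, hS₁, hBS₁⟩ := hBmem
  obtain ⟨l, hl0, hlA, hlB, hls⟩ := h.exists_circuit (union_subset (hAS.trans hsub) hBsep.1)
  -- Among the vertices of A, `a` has the smallest ratio of weight to circuit coefficient, so
  -- subtracting the circuit exhausts `a` first and keeps the others positive.
  set w : ℕ → ℝ := fun i => if i ∈ A then (if i = a then l i else 2 * l i)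
    else if i ∈ S then 1 else 0 with hw
  have hwS : ∀ i ∉ S, w i = 0 := fun i hi => by
    have : i ∉ A := fun h => hi (hAS h)
    simp [hw, hi, this]
  have hwpos : ∀ i ∈ S, 0 < w i := fun i hi => by
    simp only [hw]
    split_ifs with h1 h2
    · exact hlA i h1
    · exact mul_pos two_pos (hlA i h1)
    · exact one_pos
  have hw0 : ∀ i, 0 ≤ w i := fun i => by
    by_cases hi : i ∈ S
    exacts [(hwpos i hi).le, (hwS i hi).ge]
  obtain ⟨S', hS', v, hv0, hvS, hs⟩ := hT'.exists_mem_weights hw0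
    (fun i hi => hwS i fun h => hi (hsub h)) ⟨a, hwpos a (hAS ha)⟩
  have hsub' := hT'.subset_vertices S' hS'
  have hAS' : ¬ A ⊆ S' := fun hsubA => hT'.not_crosses hS' hS₁ hsubA hBS₁ h
  have hne : (fun i => w i - v i) ≠ 0 := by
    intro heq
    refine hAS' fun i hi => ?_
    by_contra hn
    have h1 := congrFun heq i
    have h2 := hwpos i (hAS hi)
    simp only [hvS i hn, Pi.zero_apply] at h1
    linarith
  obtain ⟨t, ht, hc⟩ := eq_smul_circuit (M := Icc 1 m)
    (fun i hi => by rw [hwS i fun h => hi (hsub h), hvS i fun h => hi (hsub' h), sub_zero]) hne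
    (fun k hk => by simp only [sub_mul, sum_sub_distrib, hs k hk, sub_self])
    (union_subset (hAS.trans hsub) hBsep.1) hl0 hlA hlB hls
    (fun F G hFG hF hG =>
      (eq_of_crosses_of_weights hT hT' hA hB hS hS' hw0 hwS hv0 hvS hFG hF hG).1)
  have hwa : w a = l a := by simp [hw, ha]
  have hwne : ∀ i ∈ A, i ≠ a → w i = 2 * l i := fun i hi hia => by simp [hw, hi, hia]
  have htle : t ≤ 1 := by
    have h1 := hc a
    have h2 := hv0 a
    have h3 := hlA a ha
    rw [hwa] at h1
    by_contra! hlt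
    nlinarith
  have hsubS : (S ∪ B).erase a ⊆ S' := by
    intro i hi
    obtain ⟨hia, hi⟩ := mem_erase.mp hi
    by_contra hn
    have h1 := hc i
    rw [hvS i hn, sub_zero] at h1
    by_cases hiB : i ∈ B
    · have := hw0 i
      have := hlB i hiB
      nlinarith
    · have hiS : i ∈ S := (mem_union.mp hi).resolve_right hiB
      by_cases hiA : i ∈ A
      · rw [hwne i hiA hia] at h1
        have := hlA i hiA
        nlinarith
      · have := hwpos i hiS
        rw [hl0 i (by simp [hiA, hiB]), mul_zero] at h1
        linarith
  have haSB : a ∈ S ∪ B := mem_union_left _ (hAS ha)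
  have hcard1 := card_le_card hsubS
  rw [card_erase_of_mem haSB, hT'.card_eq S' hS'] at hcard1
  have hXsub : A ∪ B ⊆ S ∪ B := union_subset_union_left hAS
  -- S' has 2d + 1 vertices and contains (S ∪ B) \ a, so S ∪ B has at most 2d + 2 elements, already
  -- the size of A ∪ B.
  have hX : A ∪ B = S ∪ B :=
    eq_of_subset_of_card_le hXsub (by rw [h.card_union]; omega)
  have hXcard := h.card_union
  constructor
  · rw [← hX] at hsubS
    rwa [eq_of_subset_of_card_le hsubS (by
      rw [hT'.card_eq S' hS', card_erase_of_mem (mem_union_left _ ha), hXcard]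
      rfl)]
  · obtain ⟨b, hb, rfl⟩ := exists_eq_erase (F := S) (X := A ∪ B) (hX ▸ subset_union_left) (by omega)
    exact ⟨b, (mem_union.mp hb).resolve_left fun hbA => notMem_erase b _ (hAS hbA), rfl⟩

end Exchange

/-- Simplices of T containing A are exactly the lower facets of A ∪ B, those of T' containing B
exactly the upper facets, and all others are common to both. -/
theorem isIncreasingFlip_of_tupleSet {m d : ℕ} (hd : 1 ≤ d) {T T' U : Set (Finset ℕ)}
    {A B : Finset ℕ} (hT : IsTriangulation m (2 * d) T) (hT' : IsTriangulation m (2 * d) T')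
    (hA : tupleSet m d T = U ∪ {A}) (hB : tupleSet m d T' = U ∪ {B}) (hI : Intertwines d A B) :
    IsIncreasingFlip m (2 * d) T T' := by
  have hcr : Crosses d A B := Or.inl hI
  have hcard := hcr.card_union
  have hAmem : A ∈ tupleSet m d T := hA ▸ Or.inr rfl
  have hBmem : B ∈ tupleSet m d T' := hB ▸ Or.inr rfl
  obtain ⟨hAsep, S₀, hS₀, hAS₀⟩ := hAmem
  obtain ⟨hBsep, S₁, hS₁, hBS₁⟩ := hBmem
  have hdis := hcr.disjoint
  have hup : ∀ a ∈ A, (A ∪ B).erase a ∈ T' := fun a ha =>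
    (erase_mem_of_subset hT hT' hA hB hcr hS₀ hAS₀ ha).1
  have hlow : ∀ b ∈ B, (A ∪ B).erase b ∈ T := fun b hb => by
    have := (erase_mem_of_subset hT' hT hB hA hcr.symm hS₁ hBS₁ hb).1
    rwa [union_comm] at this
  obtain ⟨a₀, ha₀⟩ : A.Nonempty := by rw [← card_pos, hI.card_left]; omega
  obtain ⟨b₀, hb₀⟩ : B.Nonempty := by rw [← card_pos, hI.card_right]; omega
  have hportion : ∀ S, S ∈ portion (2 * d) T (A ∪ B) ↔ ∃ b ∈ B, S = (A ∪ B).erase b := by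
    intro S
    constructor
    · rintro ⟨hS, hsub⟩
      -- Convex position turns the inclusion of hulls into one of vertex sets.
      have hSX : S ⊆ A ∪ B := fun i hi => mem_of_momentCurve_mem_hull (by omega)
        (hsub (subset_convexHull ℝ _ ⟨i, hi, rfl⟩))
      obtain ⟨x, hx, rfl⟩ := exists_eq_erase hSX (by rw [hcard, hT.card_eq S hS])
      refine ⟨x, (mem_union.mp hx).resolve_left fun hxA => ?_, rfl⟩
      exact hT.not_crosses hS₀ hS hAS₀
        (subset_erase.mpr ⟨subset_union_right, disjoint_left.mp hdis hxA⟩) hcr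
    · rintro ⟨b, hb, rfl⟩
      exact ⟨hlow b hb, hull_mono (erase_subset _ _)⟩
  refine ⟨A ∪ B, union_subset hAsep.1 hBsep.1, hcard, ?_, ?_⟩
  · ext S
    rw [hportion]
    exact (isLowerFacet_iff hd hI).symm
  · ext S
    constructor
    · intro hS
      by_cases hBS : B ⊆ S
      · obtain ⟨-, a, ha, rfl⟩ := erase_mem_of_subset hT' hT hB hA hcr.symm hS hBS hb₀
        refine Or.inr ((isUpperFacet_iff hd hI).mpr ⟨a, ha, ?_⟩)
        rw [union_comm]
      · refine Or.inl ⟨mem_of_not_subset hT' hT hB hA hS hBS, fun hp => ?_⟩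
        obtain ⟨b, hb, rfl⟩ := (hportion S).mp hp
        exact hT'.not_crosses hS hS₁
          (subset_erase.mpr ⟨subset_union_left, disjoint_right.mp hdis hb⟩) hBS₁ hcr
    · rintro (⟨hS, hp⟩ | hS)
      · refine mem_of_not_subset hT hT' hA hB hS fun hAS => hp ?_
        exact (hportion S).mpr (erase_mem_of_subset hT hT' hA hB hcr hS hAS ha₀).2
      · obtain ⟨a, ha, rfl⟩ := (isUpperFacet_iff hd hI).mp hS
        exact hup a ha

end CyclicPolytope

open CyclicPolytope in
theorem theoremA (m d : ℕ) (hd : 1 ≤ d) (T T' : Set (Finset ℕ))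
    (hT : IsTriangulation m (2 * d) T) (hT' : IsTriangulation m (2 * d) T') :
    (IsIncreasingFlip m (2 * d) T T' ↔
      ∃ (U : Set (Finset ℕ)) (A B : Finset ℕ),
        tupleSet m d T = U ∪ {A} ∧ tupleSet m d T' = U ∪ {B} ∧ Intertwines d A B) ∧
    (SecondLE m (2 * d) T T' ↔
      ∀ A ∈ tupleSet m d T, ¬ ∃ B ∈ tupleSet m d T', Intertwines d B A) :=
  ⟨⟨tupleSet_of_isIncreasingFlip hd hT', fun ⟨_, _, _, hA, hB, hI⟩ =>
    isIncreasingFlip_of_tupleSet hd hT hT' hA hB hI⟩, secondLE_iff hT hT'⟩
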